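/- Identify $\mathbb R^2$ with $\mathbb C$ and let $x,y,X,Y\in\mathbb R^2$. A *bounded curvature path* from $(x,X)$ to $(y,Y)$ is a map $\gamma:[0,s]\to\mathbb R^2$, $s>0$, that is $C^1$ and piecewise $C^2$ (that is, $C^2$ on each closed interval of some finite subdivision of $[0,s]$) with $\|\gamma'(t)\|=1$ for all $t\in[0,s]$, with $\gamma(0)=x$, $\gamma'(0)=X$, $\gamma(s)=y$, $\gamma'(s)=Y$, and with $\|\gamma''(t)\|\le 1$ for every $t\in[0,s]$ at which $\gamma''(t)$ exists; here derivatives at $0$ and $s$ are one-sided. Its length is $s$. The set of all these paths, for all $s>0$, is denoted by $\Gamma((x,X),(y,Y))$. A *cs path* is a bounded curvature path $\gamma:[0,s]\to\mathbb R^2$ for which there are finitely many points $0=t_0<t_1<\dots<t_n=s$ such that the restriction of $\gamma$ to each $[t_{i-1},t_i]$ is a line segment or an arc of a circle of radius $1$, traversed in either direction. Two paths $\gamma,\eta\in\Gamma((x,X),(y,Y))$ are *bounded-homotopic* if there is a family $(H_p)_{p\in[0,1]}$ of paths $H_p:[0,s_p]\to\mathbb R^2$ in $\Gamma((x,X),(y,Y))$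 with $H_0=\gamma$ and $H_1=\eta$ that is continuous in the $C^1$ sense: $p\mapsto s_p$ is continuous on $[0,1]$, and $(p,u)\mapsto H_p(us_p)$ and $(p,u)\mapsto H_p'(us_p)$ are continuous on $[0,1]\times[0,1]$. **Theorem (Normalisation).** For every bounded curvature path $\gamma\in\Gamma((x,X),(y,Y))$ there is a cs path $\eta\in\Gamma((x,X),(y,Y))$ that is bounded-homotopic to $\gamma$ and whose length is at most the length of $\gamma$. -/

import Mathlib

open Set

/-- The Euclidean plane is `ℂ`, viewed as a real normed space. The velocity at time `t` of a
curve `γ` with domain `[0, s]` (one-sided at the two ends of the interval). -/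
noncomputable def velocity (γ : ℝ → ℂ) (s t : ℝ) : ℂ :=
  derivWithin γ (Icc 0 s) t

/-- `0 = t 0 < t 1 < ⋯ < t n = s`. -/
def IsSubdivision (t : ℕ → ℝ) (n : ℕ) (s : ℝ) : Prop :=
  t 0 = 0 ∧ t n = s ∧ ∀ i < n, t i < t (i + 1)

/-- The space `Γ(x, y)` of bounded curvature paths from the point `x.1` with tangent vector `x.2`
to the point `y.1` with tangent vector `y.2`. The domain of the path is `[0, length]`; the values
of `toFun` outside this interval are irrelevant. -/
structure BoundedCurvaturePath (x y : ℂ × ℂ) where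
  /-- The right end of the domain, which is the arc length of the path. -/
  length : ℝ
  length_pos : 0 < length
  /-- The path itself. -/
  toFun : ℝ → ℂ
  /-- The path is `C¹` on its domain. -/
  contDiffOn_one : ContDiffOn ℝ 1 toFun (Icc 0 length)
  /-- The path is piecewise `C²`. -/
  piecewise_contDiffOn_two : ∃ (n : ℕ) (t : ℕ → ℝ), IsSubdivision t n length ∧
    ∀ i < n, ContDiffOn ℝ 2 toFun (Icc (t i) (t (i + 1)))
  /-- The path is parametrised by arc length. -/
  norm_velocity : ∀ t ∈ Icc 0 length, ‖velocity toFun length t‖ = 1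
  map_zero : toFun 0 = x.1
  velocity_zero : velocity toFun length 0 = x.2
  map_length : toFun length = y.1
  velocity_length : velocity toFun length length = y.2
  /-- The second derivative has norm at most one wherever it exists. -/
  curvature_le : ∀ t ∈ Icc 0 length,
    DifferentiableWithinAt ℝ (velocity toFun length) (Icc 0 length) t →
      ‖derivWithin (velocity toFun length) (Icc 0 length) t‖ ≤ 1

/-- On `[a, b]` the curve `γ` runs along a line segment. -/
def IsSegmentOn (γ : ℝ → ℂ) (a b : ℝ) : Prop :=
  ∃ c v : ℂ, ‖v‖ = 1 ∧ ∀ t ∈ Icc a b, γ t = c + (t : ℂ) * v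

/-- On `[a, b]` the curve `γ` runs at unit speed along an arc of a circle of radius one,
counterclockwise (`ε = 1`) or clockwise (`ε = -1`). -/
def IsUnitArcOn (γ : ℝ → ℂ) (a b : ℝ) : Prop :=
  ∃ (c : ℂ) (φ ε : ℝ), (ε = 1 ∨ ε = -1) ∧
    ∀ t ∈ Icc a b, γ t = c + Complex.exp (((φ + ε * t : ℝ) : ℂ) * Complex.I)

namespace BoundedCurvaturePath

/-- A `cs` path: a concatenation of finitely many line segments and arcs of unit circles. -/
def IsCS {x y : ℂ × ℂ} (γ : BoundedCurvaturePath x y) : Prop :=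
  ∃ (n : ℕ) (t : ℕ → ℝ), IsSubdivision t n γ.length ∧
    ∀ i < n, IsSegmentOn γ.toFun (t i) (t (i + 1)) ∨ IsUnitArcOn γ.toFun (t i) (t (i + 1))

/-- Two elements of `Γ(x, y)` are the same curve: they agree on their common domain. -/
def SameCurve {x y : ℂ × ℂ} (γ η : BoundedCurvaturePath x y) : Prop :=
  γ.length = η.length ∧ EqOn γ.toFun η.toFun (Icc 0 γ.length)

/-- A bounded curvature homotopy from `γ` to `η`: a family `H p`, `p ∈ [0, 1]`, of elements of
`Γ(x, y)`, each on its own interval `[0, s_p]`, that runs from `γ` to `η` and is continuous in the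
`C¹` sense: the length `s_p` depends continuously on `p`, and position and velocity at the point
with parameter `u * s_p`, `u ∈ [0, 1]`, depend continuously on `(p, u)`. -/
structure IsBoundedCurvatureHomotopy {x y : ℂ × ℂ} (γ η : BoundedCurvaturePath x y)
    (H : unitInterval → BoundedCurvaturePath x y) : Prop where
  continuous_length : Continuous fun p => (H p).length
  continuous_position : Continuous fun q : unitInterval × unitInterval =>
    (H q.1).toFun ((q.2 : ℝ) * (H q.1).length)
  continuous_velocity : Continuous fun q : unitInterval × unitInterval =>
    velocity (H q.1).toFun (H q.1).length ((q.2 : ℝ) * (H q.1).length)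
  source : SameCurve (H 0) γ
  target : SameCurve (H 1) η

/-- The two paths are bounded-homotopic. -/
def BoundedHomotopic {x y : ℂ × ℂ} (γ η : BoundedCurvaturePath x y) : Prop :=
  ∃ H : unitInterval → BoundedCurvaturePath x y, IsBoundedCurvatureHomotopy γ η H

end BoundedCurvaturePath

/-- `PiecewiseOn P a b`: the interval `[a, b]` is a finite union of consecutive, possibly
degenerate, intervals with property `P`. -/
inductive PiecewiseOn (P : ℝ → ℝ → Prop) : ℝ → ℝ → Prop
  | refl (a : ℝ) : PiecewiseOn P a a
  | snoc {a b c : ℝ} : PiecewiseOn P a b → b ≤ c → P b c → PiecewiseOn P a c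

namespace PiecewiseOn

variable {P Q : ℝ → ℝ → Prop} {a b c : ℝ}

theorem le (h : PiecewiseOn P a b) : a ≤ b := by
  induction h with
  | refl => exact le_rfl
  | snoc _ hbc _ ih => exact ih.trans hbc

theorem single (hab : a ≤ b) (h : P a b) : PiecewiseOn P a b :=
  snoc (refl a) hab h

theorem trans (h : PiecewiseOn P a b) (h' : PiecewiseOn P b c) : PiecewiseOn P a c := by
  induction h' with
  | refl => exact h
  | snoc _ hbc hP ih => exact snoc ih hbc hP

theorem imp (h : PiecewiseOn P a b)
    (hPQ : ∀ c d, a ≤ c → c ≤ d → d ≤ b → P c d → Q c d) : PiecewiseOn Q a b := by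
  induction h with
  | refl => exact refl _
  | snoc h hbc hP ih =>
    exact snoc (ih fun c d h1 h2 h3 => hPQ c d h1 h2 (h3.trans hbc)) hbc (hPQ _ _ h.le hbc le_rfl hP)

theorem shift (h : PiecewiseOn P a b) (r : ℝ) :
    PiecewiseOn (fun c d => P (c - r) (d - r)) (a + r) (b + r) := by
  induction h with
  | refl => exact refl _
  | snoc h hbc hP ih => exact snoc ih (by linarith) (by simpa using hP)

theorem restrict_left (h : PiecewiseOn P a c)
    (hP : ∀ p q p' q', p ≤ p' → p' ≤ q' → q' ≤ q → P p q → P p' q')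
    (hab : a ≤ b) (hbc : b ≤ c) : PiecewiseOn P a b := by
  induction h with
  | refl => rw [le_antisymm hbc hab]; exact refl _
  | @snoc d e h hde hPd ih =>
    rcases le_total b d with hbd | hdb
    · exact ih hbd
    · exact snoc h hdb (hP _ _ _ _ le_rfl hdb hbc hPd)

theorem restrict_right (h : PiecewiseOn P a c)
    (hP : ∀ p q p' q', p ≤ p' → p' ≤ q' → q' ≤ q → P p q → P p' q')
    (hab : a ≤ b) (hbc : b ≤ c) : PiecewiseOn P b c := by
  induction h with
  | refl => rw [le_antisymm hbc hab]; exact refl _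
  | @snoc d e h hde hPd ih =>
    rcases le_total b d with hbd | hdb
    · exact snoc (ih hbd) hde hPd
    · exact single hbc (hP _ _ _ _ hdb hbc le_rfl hPd)

theorem of_subdivision {n : ℕ} {t : ℕ → ℝ} (ht : ∀ i < n, t i < t (i + 1))
    (hP : ∀ i < n, P (t i) (t (i + 1))) : PiecewiseOn P (t 0) (t n) := by
  induction n with
  | zero => exact refl _
  | succ n ih =>
    exact snoc (ih (fun i hi => ht i (by omega)) (fun i hi => hP i (by omega)))
      (ht n (by omega)).le (hP n (by omega))

theorem exists_subdivision (h : PiecewiseOn P a b) :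
    ∃ (n : ℕ) (t : ℕ → ℝ), t 0 = a ∧ t n = b ∧ (∀ i < n, t i < t (i + 1)) ∧
      ∀ i < n, P (t i) (t (i + 1)) := by
  induction h with
  | refl => exact ⟨0, fun _ => a, rfl, rfl, by simp, by simp⟩
  | @snoc b c h hbc hP ih =>
    obtain ⟨n, t, h0, hn, hlt, hPt⟩ := ih
    rcases hbc.eq_or_lt with rfl | hbc
    · exact ⟨n, t, h0, hn, hlt, hPt⟩
    · refine ⟨n + 1, fun i => if i ≤ n then t i else c, by simpa using h0, by simp, ?_, ?_⟩ <;>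
      · intro i hi
        rcases (Nat.lt_succ_iff.1 hi).eq_or_lt with rfl | hi'
        · simpa [hn]
        · simp only [hi'.le, Nat.succ_le_iff.2 hi', if_true]
          first | exact hlt i hi' | exact hPt i hi'

end PiecewiseOn

theorem LipschitzOnWith.Icc_union {E : Type*} [PseudoEMetricSpace E] {f : ℝ → E} {a b c : ℝ}
    (h₁ : LipschitzOnWith 1 f (Icc a b)) (h₂ : LipschitzOnWith 1 f (Icc b c)) :
    LipschitzOnWith 1 f (Icc a c) := by
  have key : ∀ x ∈ Icc a c, ∀ y ∈ Icc a c, x ≤ y → edist (f x) (f y) ≤ edist x y := by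
    intro x hx y hy hxy
    rcases le_total y b with hyb | hby
    · simpa using h₁ ⟨hx.1, hxy.trans hyb⟩ ⟨hy.1, hyb⟩
    rcases le_total b x with hbx | hxb
    · simpa using h₂ ⟨hbx, hx.2⟩ ⟨hby, hy.2⟩
    have e1 := h₁ ⟨hx.1, hxb⟩ ⟨hx.1.trans hxb, le_rfl⟩
    have e2 := h₂ ⟨le_rfl, hby.trans hy.2⟩ ⟨hby, hy.2⟩
    simp only [ENNReal.coe_one, one_mul] at e1 e2
    refine (edist_triangle _ (f b) _).trans ((add_le_add e1 e2).trans_eq ?_)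
    rw [edist_dist, edist_dist, edist_dist, ← ENNReal.ofReal_add dist_nonneg dist_nonneg]
    congr 1
    rw [Real.dist_eq, Real.dist_eq, Real.dist_eq, abs_of_nonpos (by linarith),
      abs_of_nonpos (by linarith), abs_of_nonpos (by linarith)]
    ring
  intro x hx y hy
  rw [ENNReal.coe_one, one_mul]
  rcases le_total x y with h | h
  · exact key x hx y hy h
  · rw [edist_comm, edist_comm x]; exact key y hy x hx h

theorem PiecewiseOn.lipschitzOnWith {E : Type*} [PseudoEMetricSpace E] {f : ℝ → E} {a b : ℝ}
    (h : PiecewiseOn (fun c d => LipschitzOnWith 1 f (Icc c d)) a b) :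
    LipschitzOnWith 1 f (Icc a b) := by
  induction h with
  | refl => rintro x ⟨hx, hx'⟩ y ⟨hy, hy'⟩; simp [le_antisymm hx' hx, le_antisymm hy' hy]
  | snoc _ _ hP ih => exact ih.Icc_union hP

/-- A curve in the plane up to translation, given by its length and its velocity. -/
abbrev Track := ℝ × C(ℝ, ℂ)

namespace Track

/-- `T` is the track of a bounded curvature path (or a constant path) with displacement `d` whose
velocity runs from `X` to `Y`. The velocity is constant on the negative half-line. -/
structure Admissible (X Y d : ℂ) (T : Track) : Prop where
  nonneg : 0 ≤ T.1
  of_nonpos : ∀ τ ≤ 0, T.2 τ = X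
  terminal : T.2 T.1 = Y
  integral : ∫ τ in (0 : ℝ)..T.1, T.2 τ = d
  norm_eq : ∀ τ ∈ Icc 0 T.1, ‖T.2 τ‖ = 1
  lipschitz : LipschitzOnWith 1 T.2 (Icc 0 T.1)
  piecewise : PiecewiseOn (fun a b => ContDiffOn ℝ 1 T.2 (Icc a b)) 0 T.1

/-- The velocity is constant or rotates with constant angular velocity `±1` on `[a, b]`. -/
def IsSteady (v : ℝ → ℂ) (a b : ℝ) : Prop :=
  (∃ w : ℂ, ∀ τ ∈ Icc a b, v τ = w) ∨ ∃ (w : ℂ) (ε : ℝ), (ε = 1 ∨ ε = -1) ∧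
    ∀ τ ∈ Icc a b, v τ = w * Complex.exp ((ε * τ : ℝ) * Complex.I)

/-- The track of a `cs` path. -/
def IsCS (T : Track) : Prop := PiecewiseOn (IsSteady T.2) 0 T.1

/-- Concatenation of tracks; the second one should start with the terminal velocity of the first
one. -/
noncomputable def concat (T₁ T₂ : Track) : Track :=
  (T₁.1 + T₂.1, ⟨fun τ => T₁.2 (min τ T₁.1) + T₂.2 (max (τ - T₁.1) 0) - T₁.2 T₁.1, by fun_prop⟩)

theorem continuous_concat : Continuous fun p : Track × Track => concat p.1 p.2 := by
  refine Continuous.prodMk (by fun_prop) ?_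
  apply ContinuousMap.continuous_of_continuous_uncurry
  change Continuous fun q : (Track × Track) × ℝ => q.1.1.2 (min q.2 q.1.1.1)
    + q.1.2.2 (max (q.2 - q.1.1.1) 0) - q.1.1.2 q.1.1.1
  fun_prop

theorem concat_apply (T₁ T₂ : Track) (τ : ℝ) : (concat T₁ T₂).2 τ =
    T₁.2 (min τ T₁.1) + T₂.2 (max (τ - T₁.1) 0) - T₁.2 T₁.1 := rfl

theorem concat_fst (T₁ T₂ : Track) : (concat T₁ T₂).1 = T₁.1 + T₂.1 := rfl

variable {T T₁ T₂ : Track} {X Y Z d e : ℂ}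

theorem concat_of_le (h : T₂.2 0 = T₁.2 T₁.1) {τ : ℝ} (hτ : τ ≤ T₁.1) :
    (concat T₁ T₂).2 τ = T₁.2 τ := by
  rw [concat_apply, min_eq_left hτ, max_eq_right (by linarith), h]; ring

theorem concat_of_ge {τ : ℝ} (hτ : T₁.1 ≤ τ) :
    (concat T₁ T₂).2 τ = T₂.2 (τ - T₁.1) := by
  rw [concat_apply, min_eq_right hτ, max_eq_left (by linarith)]; ring

theorem piecewiseOn_concat {P : (ℝ → ℂ) → ℝ → ℝ → Prop}
    (hcongr : ∀ v w a b, EqOn w v (Icc a b) → P v a b → P w a b)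
    (hshift : ∀ v a b r, P v (a - r) (b - r) → P (fun τ => v (τ - r)) a b)
    (h : T₂.2 0 = T₁.2 T₁.1) (h₁ : PiecewiseOn (P T₁.2) 0 T₁.1) (h₂ : PiecewiseOn (P T₂.2) 0 T₂.1) :
    PiecewiseOn (P (concat T₁ T₂).2) 0 (concat T₁ T₂).1 := by
  refine (h₁.imp (Q := P (concat T₁ T₂).2) fun c d _ _ hd hP =>
    hcongr _ _ _ _ (fun τ hτ => concat_of_le h (hτ.2.trans hd)) hP).trans ?_
  have := h₂.shift T₁.1
  rw [zero_add, add_comm] at this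
  exact this.imp fun c d hc _ _ hP => hcongr _ _ _ _
    (fun τ hτ => concat_of_ge (hc.trans hτ.1)) (hshift _ _ _ _ hP)

theorem IsCS.concat (h : T₂.2 0 = T₁.2 T₁.1) (h₁ : T₁.IsCS) (h₂ : T₂.IsCS) :
    (concat T₁ T₂).IsCS := by
  refine piecewiseOn_concat (P := IsSteady) ?_ ?_ h h₁ h₂
  · rintro v w a b hvw (⟨c, hc⟩ | ⟨c, ε, hε, hc⟩)
    · exact Or.inl ⟨c, fun τ hτ => (hvw hτ).trans (hc τ hτ)⟩
    · exact Or.inr ⟨c, ε, hε, fun τ hτ => (hvw hτ).trans (hc τ hτ)⟩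
  · rintro v a b r (⟨c, hc⟩ | ⟨c, ε, hε, hc⟩)
    · exact Or.inl ⟨c, fun τ hτ => hc _ ⟨by linarith [hτ.1], by linarith [hτ.2]⟩⟩
    · refine Or.inr ⟨c * Complex.exp ((-(ε * r) : ℝ) * Complex.I), ε, hε, fun τ hτ => ?_⟩
      simp only
      rw [hc _ ⟨by linarith [hτ.1], by linarith [hτ.2]⟩, mul_assoc, ← Complex.exp_add]
      congr 2
      push_cast
      ring

theorem Admissible.initial (h : Admissible X Y d T) : T.2 0 = X := h.of_nonpos 0 le_rfl

theorem lipschitzOnWith_sub_right {v : ℝ → ℂ} {a b r : ℝ}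
    (h : LipschitzOnWith 1 v (Icc (a - r) (b - r))) :
    LipschitzOnWith 1 (fun τ => v (τ - r)) (Icc a b) := by
  intro x hx y hy
  have := h (x := x - r) ⟨by linarith [hx.1], by linarith [hx.2]⟩
    (y := y - r) ⟨by linarith [hy.1], by linarith [hy.2]⟩
  simpa [edist_dist, Real.dist_eq] using this

theorem contDiffOn_sub_right {v : ℝ → ℂ} {a b r : ℝ}
    (h : ContDiffOn ℝ 1 v (Icc (a - r) (b - r))) :
    ContDiffOn ℝ 1 (fun τ => v (τ - r)) (Icc a b) :=
  h.comp (by fun_prop) fun x hx => ⟨by linarith [hx.1], by linarith [hx.2]⟩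

theorem Admissible.concat (h₁ : Admissible X Y d T₁) (h₂ : Admissible Y Z e T₂) :
    Admissible X Z (d + e) (concat T₁ T₂) := by
  have hY : T₂.2 0 = T₁.2 T₁.1 := h₂.initial.trans h₁.terminal.symm
  have n₁ := h₁.nonneg
  have n₂ := h₂.nonneg
  refine ⟨add_nonneg n₁ n₂, ?_, ?_, ?_, ?_, ?_, ?_⟩
  · intro τ hτ
    rw [concat_of_le hY (hτ.trans n₁), h₁.of_nonpos τ hτ]
  · rw [concat_of_ge (by simpa [concat_fst] using n₂), concat_fst, add_sub_cancel_left, h₂.terminal]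
  · rw [concat_fst, ← intervalIntegral.integral_add_adjacent_intervals (b := T₁.1)
      ((Track.concat T₁ T₂).2.continuous.intervalIntegrable _ _)
      ((Track.concat T₁ T₂).2.continuous.intervalIntegrable _ _)]
    congr 1
    · rw [← h₁.integral]
      refine intervalIntegral.integral_congr fun τ hτ => ?_
      rw [uIcc_of_le n₁] at hτ
      exact concat_of_le hY hτ.2
    · have : ∫ τ in T₁.1..(T₁.1 + T₂.1), (Track.concat T₁ T₂).2 τ
          = ∫ τ in T₁.1..(T₁.1 + T₂.1), T₂.2 (τ - T₁.1) := by
        refine intervalIntegral.integral_congr fun τ hτ => ?_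
        rw [uIcc_of_le (by linarith)] at hτ
        exact concat_of_ge hτ.1
      rw [this, intervalIntegral.integral_comp_sub_right (fun τ => T₂.2 τ)]
      simpa using h₂.integral
  · intro τ hτ
    rcases le_total τ T₁.1 with h | h
    · rw [concat_of_le hY h]; exact h₁.norm_eq τ ⟨hτ.1, h⟩
    · rw [concat_of_ge h]
      exact h₂.norm_eq _ ⟨by linarith, by have := hτ.2; rw [concat_fst] at this; linarith⟩
  · apply PiecewiseOn.lipschitzOnWith
    refine piecewiseOn_concat (P := fun v a b => LipschitzOnWith 1 v (Icc a b))
      ?_ (fun v a b r => lipschitzOnWith_sub_right) hY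
      (PiecewiseOn.single n₁ h₁.lipschitz) (PiecewiseOn.single n₂ h₂.lipschitz)
    intro v w a b hvw h x hx y hy
    rw [hvw hx, hvw hy]; exact h hx hy
  · exact piecewiseOn_concat (P := fun v a b => ContDiffOn ℝ 1 v (Icc a b))
      (fun v w a b hvw h => h.congr hvw) (fun v a b r => contDiffOn_sub_right) hY
      h₁.piecewise h₂.piecewise

/-- The part of a track after time `t`. -/
noncomputable def tail (T : Track) (t : ℝ) : Track :=
  (T.1 - t, ⟨fun τ => T.2 (max τ 0 + t), by fun_prop⟩)

theorem continuous_tail (T : Track) : Continuous (tail T) := by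
  refine Continuous.prodMk (by fun_prop) ?_
  apply ContinuousMap.continuous_of_continuous_uncurry
  change Continuous fun q : ℝ × ℝ => T.2 (max q.2 0 + q.1)
  fun_prop

theorem Admissible.tail (h : Admissible X Y d T) {t : ℝ} (h0 : 0 ≤ t) (ht : t ≤ T.1) :
    Admissible (T.2 t) Y (d - ∫ τ in (0 : ℝ)..t, T.2 τ) (tail T t) := by
  have e : ∀ τ, 0 ≤ τ → (Track.tail T t).2 τ = T.2 (τ - -t) := fun τ hτ => by
    change T.2 (max τ 0 + t) = _
    rw [max_eq_left hτ, sub_neg_eq_add]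
  have e1 : (Track.tail T t).1 = T.1 - t := rfl
  refine ⟨by rw [e1]; linarith, fun τ hτ => ?_, ?_, ?_, ?_, ?_, ?_⟩
  · change T.2 (max τ 0 + t) = _
    rw [max_eq_right hτ, zero_add]
  · rw [e _ (by rw [e1]; linarith), e1, ← h.terminal]
    congr 1
    ring
  · have : ∫ τ in (0 : ℝ)..(Track.tail T t).1, (Track.tail T t).2 τ
        = ∫ τ in (0 : ℝ)..(T.1 - t), T.2 (τ - -t) := by
      refine intervalIntegral.integral_congr fun τ hτ => ?_
      rw [e1, uIcc_of_le (by linarith)] at hτ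
      exact e τ hτ.1
    rw [this, intervalIntegral.integral_comp_sub_right (fun τ => T.2 τ), ← h.integral,
      eq_sub_iff_add_eq, add_comm]
    simp only [sub_neg_eq_add, zero_add, sub_add_cancel]
    exact intervalIntegral.integral_add_adjacent_intervals
      (T.2.continuous.intervalIntegrable _ _) (T.2.continuous.intervalIntegrable _ _)
  · intro τ hτ
    rw [e1] at hτ
    rw [e τ hτ.1]
    exact h.norm_eq _ ⟨by linarith [hτ.1], by linarith [hτ.2]⟩
  · have : LipschitzOnWith 1 (fun τ => T.2 (τ - -t)) (Icc 0 (T.1 - t)) :=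
      lipschitzOnWith_sub_right (h.lipschitz.mono (Icc_subset_Icc (by linarith) (by linarith)))
    intro x hx y hy
    rw [e1] at hx hy
    rw [e x hx.1, e y hy.1]
    exact this hx hy
  · have := (h.piecewise.restrict_right
      (fun p q p' q' h1 _ h2 hp => hp.mono (Icc_subset_Icc h1 h2)) h0 ht).shift (-t)
    rw [add_neg_cancel, ← sub_eq_add_neg] at this
    exact this.imp fun p q hp _ _ hP => (contDiffOn_sub_right hP).congr
      fun τ hτ => e τ (hp.trans hτ.1)

theorem tail_zero (h : Admissible X Y d T) : tail T 0 = T := by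
  refine Prod.ext (sub_zero _) (ContinuousMap.ext fun τ => ?_)
  change T.2 (max τ 0 + 0) = T.2 τ
  rcases le_total τ 0 with h' | h'
  · rw [max_eq_right h', h.of_nonpos _ h', h.of_nonpos _ (by simp)]
  · rw [max_eq_left h', add_zero]

end Track

/-- The odd primitive of `x ↦ sin |x|`, i.e. `x ↦ sign x * (1 - cos x)`. -/
noncomputable def signedVersine (x : ℝ) : ℝ := ∫ w in (0 : ℝ)..x, Real.sin |w|

theorem hasDerivAt_signedVersine (x : ℝ) : HasDerivAt signedVersine (Real.sin |x|) x :=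
  intervalIntegral.integral_hasDerivAt_right
    (Continuous.intervalIntegrable (by fun_prop) _ _)
    (Continuous.stronglyMeasurableAtFilter (by fun_prop) _ _)
    (Continuous.continuousAt (by fun_prop))

theorem signedVersine_neg (x : ℝ) : signedVersine (-x) = -signedVersine x := by
  unfold signedVersine
  have := intervalIntegral.integral_comp_neg (a := 0) (b := x) (fun w => Real.sin |w|)
  simp only [abs_neg, neg_zero] at this
  rw [this, intervalIntegral.integral_symm]

theorem signedVersine_of_nonneg {x : ℝ} (hx : 0 ≤ x) : signedVersine x = 1 - Real.cos x := by
  have : ∫ w in (0 : ℝ)..x, Real.sin |w| = ∫ w in (0 : ℝ)..x, Real.sin w := by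
    refine intervalIntegral.integral_congr fun w hw => ?_
    rw [uIcc_of_le hx] at hw
    simp only [abs_of_nonneg hw.1]
  rw [signedVersine, this, integral_sin, Real.cos_zero]

theorem continuous_signedVersine : Continuous signedVersine :=
  continuous_iff_continuousAt.2 fun x => (hasDerivAt_signedVersine x).continuousAt

theorem norm_exp_mul_I_sub_le (x y : ℝ) :
    ‖Complex.exp (x * Complex.I) - Complex.exp (y * Complex.I)‖ ≤ |x - y| := by
  have h : Complex.exp (x * Complex.I) - Complex.exp (y * Complex.I)
      = Complex.exp (y * Complex.I) * (Complex.exp (Complex.I * (x - y : ℝ)) - 1) := by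
    rw [mul_sub, ← Complex.exp_add, mul_one]
    congr 2
    push_cast
    ring
  rw [h, norm_mul, Complex.norm_exp_ofReal_mul_I, one_mul]
  exact Real.norm_exp_I_mul_ofReal_sub_one_le

namespace Track

/-- Clamp of `a` to the interval `[-τ⁺, τ⁺]`: the heading at time `τ` of a curve that turns by the
total angle `a` at unit angular speed. -/
noncomputable def turn (a τ : ℝ) : ℝ := max (-(max τ 0)) (min (max τ 0) a)

theorem continuous_turn : Continuous fun p : ℝ × ℝ => turn p.1 p.2 := by
  unfold turn
  fun_prop

theorem turn_of_nonpos {a τ : ℝ} (h : τ ≤ 0) : turn a τ = 0 := by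
  unfold turn
  rw [max_eq_right h]
  simp

theorem turn_of_nonneg {a τ : ℝ} (ha : 0 ≤ a) (hτ : 0 ≤ τ) : turn a τ = min τ a := by
  unfold turn
  rw [max_eq_left hτ]
  exact max_eq_right (by linarith [le_min hτ ha])

theorem turn_of_abs_le {a τ : ℝ} (h : |a| ≤ τ) : turn a τ = a := by
  unfold turn
  rw [max_eq_left ((abs_nonneg a).trans h), min_eq_right ((le_abs_self a).trans h)]
  exact max_eq_right (by linarith [neg_abs_le a])

theorem turn_neg (a τ : ℝ) : turn (-a) τ = -turn a τ := by
  unfold turn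
  have : 0 ≤ max τ 0 := le_max_right _ _
  generalize max τ 0 = m at *
  simp only [max_def, min_def]
  split_ifs <;> linarith

theorem turn_of_le_abs (a : ℝ) : ∃ ε : ℝ, (ε = 1 ∨ ε = -1) ∧ a = ε * |a| ∧
    ∀ τ ∈ Icc 0 |a|, turn a τ = ε * τ := by
  rcases le_total 0 a with ha | ha
  · refine ⟨1, Or.inl rfl, by rw [abs_of_nonneg ha, one_mul], fun τ hτ => ?_⟩
    rw [abs_of_nonneg ha] at hτ
    rw [turn_of_nonneg ha hτ.1, min_eq_left hτ.2, one_mul]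
  · refine ⟨-1, Or.inr rfl, by rw [abs_of_nonpos ha]; ring, fun τ hτ => ?_⟩
    rw [abs_of_nonpos ha] at hτ
    rw [← neg_neg a, turn_neg, turn_of_nonneg (by linarith) hτ.1, min_eq_left hτ.2]
    ring

/-- The arc of a unit circle with initial velocity `X` and signed angle `a`. -/
noncomputable def arc (X : ℂ) (a : ℝ) : Track :=
  (|a|, ⟨fun τ => X * Complex.exp (turn a τ * Complex.I), by unfold turn; fun_prop⟩)

/-- The line segment with direction `X` and length `l`. -/
noncomputable def segment (X : ℂ) (l : ℝ) : Track := (l, ContinuousMap.const ℝ X)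

theorem continuous_arc : Continuous fun p : ℂ × ℝ => arc p.1 p.2 := by
  refine Continuous.prodMk (by fun_prop) ?_
  apply ContinuousMap.continuous_of_continuous_uncurry
  change Continuous fun q : (ℂ × ℝ) × ℝ => q.1.1 * Complex.exp (turn q.1.2 q.2 * Complex.I)
  have : Continuous fun q : (ℂ × ℝ) × ℝ => turn q.1.2 q.2 :=
    continuous_turn.comp (f := fun q : (ℂ × ℝ) × ℝ => (q.1.2, q.2)) (by fun_prop)
  fun_prop

theorem continuous_segment : Continuous fun p : ℂ × ℝ => segment p.1 p.2 := by
  refine Continuous.prodMk (by fun_prop) ?_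
  apply ContinuousMap.continuous_of_continuous_uncurry
  change Continuous fun q : (ℂ × ℝ) × ℝ => q.1.1
  fun_prop

theorem arc_apply (X : ℂ) (a τ : ℝ) : (arc X a).2 τ = X * Complex.exp (turn a τ * Complex.I) := rfl

theorem arc_fst (X : ℂ) (a : ℝ) : (arc X a).1 = |a| := rfl

theorem arc_initial (X : ℂ) (a : ℝ) : (arc X a).2 0 = X := by
  simp [arc_apply, turn_of_nonpos]

theorem arc_terminal (X : ℂ) (a : ℝ) : (arc X a).2 |a| = X * Complex.exp (a * Complex.I) := by
  rw [arc_apply, turn_of_abs_le le_rfl]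

theorem integral_exp_mul_I (ε L : ℝ) (hε : ε = 1 ∨ ε = -1) (hL : 0 ≤ L) :
    ∫ τ in (0 : ℝ)..L, Complex.exp ((ε * τ : ℝ) * Complex.I)
      = (Real.sin L : ℂ) + signedVersine (ε * L) * Complex.I := by
  have hne : (ε : ℂ) * Complex.I ≠ 0 := by
    rcases hε with rfl | rfl <;> simp
  have h1 : ∀ τ : ℝ, Complex.exp ((ε * τ : ℝ) * Complex.I) = Complex.exp ((ε * Complex.I) * τ) := by
    intro τ
    congr 1
    push_cast
    ring
  simp_rw [h1]
  rw [integral_exp_mul_complex hne, div_eq_iff hne]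
  have h2 : signedVersine (ε * L) = ε * (1 - Real.cos L) := by
    rcases hε with rfl | rfl
    · rw [one_mul, one_mul, signedVersine_of_nonneg hL]
    · rw [neg_one_mul, neg_one_mul, signedVersine_neg, signedVersine_of_nonneg hL]
  have h3 : Complex.exp ((ε * Complex.I) * L) = Real.cos L + ε * Real.sin L * Complex.I := by
    rw [← h1, Complex.exp_mul_I, ← Complex.ofReal_cos, ← Complex.ofReal_sin]
    rcases hε with rfl | rfl <;> simp
  have h4 : (ε : ℂ) * ε = 1 := by rcases hε with rfl | rfl <;> simp
  rw [h2, h3]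
  push_cast
  simp only [mul_zero, Complex.exp_zero]
  linear_combination (1 - Complex.cos L) * h4
    - (ε : ℂ) * ε * (1 - Complex.cos L) * Complex.I_mul_I

theorem arc_admissible {X : ℂ} (hX : ‖X‖ = 1) (a : ℝ) :
    Admissible X (X * Complex.exp (a * Complex.I))
      (X * (Real.sin |a| + signedVersine a * Complex.I)) (arc X a) := by
  obtain ⟨ε, hε, ha, hturn⟩ := turn_of_le_abs a
  have hv : ∀ τ ∈ Icc 0 |a|, (arc X a).2 τ = X * Complex.exp ((ε * τ : ℝ) * Complex.I) :=
    fun τ hτ => by rw [arc_apply, hturn τ hτ]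
  refine ⟨abs_nonneg a, fun τ hτ => ?_, arc_terminal X a, ?_, ?_, ?_, ?_⟩
  · simp [arc_apply, turn_of_nonpos hτ]
  · have : ∫ τ in (0 : ℝ)..(arc X a).1, (arc X a).2 τ
        = ∫ τ in (0 : ℝ)..|a|, X * Complex.exp ((ε * τ : ℝ) * Complex.I) := by
      refine intervalIntegral.integral_congr fun τ hτ => ?_
      rw [arc_fst, uIcc_of_le (abs_nonneg a)] at hτ
      exact hv τ hτ
    rw [this, intervalIntegral.integral_const_mul, integral_exp_mul_I ε |a| hε (abs_nonneg a), ← ha]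
  · intro τ _
    rw [arc_apply, norm_mul, hX, Complex.norm_exp_ofReal_mul_I, one_mul]
  · refine LipschitzOnWith.of_dist_le_mul fun x hx y hy => ?_
    rw [hv x hx, hv y hy, dist_eq_norm, ← mul_sub, norm_mul, hX, one_mul, NNReal.coe_one, one_mul,
      Real.dist_eq]
    refine (norm_exp_mul_I_sub_le _ _).trans_eq ?_
    rw [← mul_sub, abs_mul]
    rcases hε with rfl | rfl <;> simp
  · refine PiecewiseOn.single (abs_nonneg a) (ContDiffOn.congr ?_ hv)
    have : ContDiff ℝ 1 fun τ : ℝ => X * Complex.exp ((ε * τ : ℝ) * Complex.I) := by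
      have : ContDiff ℝ 1 fun τ : ℝ => ((ε * τ : ℝ) : ℂ) :=
        Complex.ofRealCLM.contDiff.comp (contDiff_const.mul contDiff_id)
      exact contDiff_const.mul ((this.mul contDiff_const).cexp)
    exact this.contDiffOn

theorem arc_isCS (X : ℂ) (a : ℝ) : (arc X a).IsCS := by
  obtain ⟨ε, hε, -, hturn⟩ := turn_of_le_abs a
  exact PiecewiseOn.single (abs_nonneg a)
    (Or.inr ⟨X, ε, hε, fun τ hτ => by rw [arc_apply, hturn τ hτ]⟩)

theorem segment_admissible {X : ℂ} (hX : ‖X‖ = 1) {l : ℝ} (hl : 0 ≤ l) :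
    Admissible X X (X * l) (segment X l) := by
  refine ⟨hl, fun _ _ => rfl, rfl, ?_, fun _ _ => hX, ?_, PiecewiseOn.single hl contDiffOn_const⟩
  · simp [segment, mul_comm]
  · exact LipschitzOnWith.of_dist_le_mul (by simp [segment])

theorem segment_isCS (X : ℂ) {l : ℝ} (hl : 0 ≤ l) : (segment X l).IsCS :=
  PiecewiseOn.single hl (Or.inl ⟨X, fun _ _ => rfl⟩)

/-- The track of type arc–segment–arc with initial velocity `X`, signed angles `a`, `b` of the arcs
and length `l` of the segment. -/
noncomputable def dubins (X : ℂ) (a l b : ℝ) : Track :=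
  concat (arc X a) (concat (segment (X * Complex.exp (a * Complex.I)) l)
    (arc (X * Complex.exp (a * Complex.I)) b))

theorem dubins_fst (X : ℂ) (a l b : ℝ) : (dubins X a l b).1 = |a| + (l + |b|) := rfl

theorem continuous_dubins (X : ℂ) :
    Continuous fun p : ℝ × ℝ × ℝ => dubins X p.1 p.2.1 p.2.2 := by
  have h1 := continuous_arc.comp (f := fun p : ℝ × ℝ × ℝ => (X, p.1)) (by fun_prop)
  have h2 := continuous_segment.comp
    (f := fun p : ℝ × ℝ × ℝ => (X * Complex.exp (p.1 * Complex.I), p.2.1)) (by fun_prop)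
  have h3 := continuous_arc.comp
    (f := fun p : ℝ × ℝ × ℝ => (X * Complex.exp (p.1 * Complex.I), p.2.2)) (by fun_prop)
  exact continuous_concat.comp (h1.prodMk (continuous_concat.comp (h2.prodMk h3)))

theorem dubins_isCS {X : ℂ} {a l b : ℝ} (hl : 0 ≤ l) : (dubins X a l b).IsCS := by
  have h1 : (arc (X * Complex.exp (a * Complex.I)) b).2 0
      = (segment (X * Complex.exp (a * Complex.I)) l).2 l := arc_initial _ _
  refine (arc_isCS X a).concat ?_ ((segment_isCS _ hl).concat h1 (arc_isCS _ b))
  rw [concat_of_le h1 hl, arc_fst, arc_terminal]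
  rfl

theorem dubins_admissible {X : ℂ} (hX : ‖X‖ = 1) {a l b C S : ℝ} (hl : 0 ≤ l)
    (hre : Real.cos a * C + Real.sin a * S = l + Real.sin |a| + Real.sin |b|)
    (him : Real.cos a * S - Real.sin a * C = signedVersine b - signedVersine a) :
    Admissible X (X * Complex.exp ((a + b : ℝ) * Complex.I)) (X * (C + S * Complex.I))
      (dubins X a l b) := by
  have hX' : ‖X * Complex.exp (a * Complex.I)‖ = 1 := by
    rw [norm_mul, hX, Complex.norm_exp_ofReal_mul_I, one_mul]
  have h := (arc_admissible hX a).concat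
    ((segment_admissible hX' hl).concat (arc_admissible hX' b))
  convert h using 1
  · rw [mul_assoc, ← Complex.exp_add]
    congr 2
    push_cast
    ring
  · obtain ⟨ε, hε, ha, -⟩ := turn_of_le_abs a
    have hL := abs_nonneg a
    have key : (Real.sin |a| : ℂ) + signedVersine a * Complex.I
        = Complex.exp (a * Complex.I) * (Real.sin |a| - signedVersine a * Complex.I) := by
      have h2 : signedVersine a = ε * (1 - Real.cos |a|) := by
        rw [← signedVersine_of_nonneg hL]
        conv_lhs => rw [ha]
        rcases hε with rfl | rfl
        · rw [one_mul, one_mul]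
        · rw [neg_one_mul, neg_one_mul, signedVersine_neg]
      have h3 : Complex.exp (a * Complex.I) = Real.cos |a| + ε * Real.sin |a| * Complex.I := by
        conv_lhs => rw [ha]
        rw [Complex.exp_mul_I, ← Complex.ofReal_cos, ← Complex.ofReal_sin]
        rcases hε with rfl | rfl <;> simp
      have h4 : (ε : ℂ) * ε = 1 := by rcases hε with rfl | rfl <;> simp
      have h5 : (Real.sin |a| : ℂ) * Real.sin |a| + Real.cos |a| * Real.cos |a| = 1 := by
        rw [← sq, ← sq]
        exact_mod_cast Real.sin_sq_add_cos_sq |a|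
      rw [h2, h3]
      push_cast at h5 ⊢
      linear_combination (-Complex.sin (|a| : ℝ) * (1 - Complex.cos (|a| : ℝ))) * h4
        + (Complex.sin (|a| : ℝ) * (1 - Complex.cos (|a| : ℝ)) * ε * ε) * Complex.I_mul_I
        - (ε : ℂ) * Complex.I * h5
    have h6 : Complex.exp (a * Complex.I) = Real.cos a + Real.sin a * Complex.I := by
      rw [Complex.exp_mul_I, ← Complex.ofReal_cos, ← Complex.ofReal_sin]
    have h7 : (Real.sin a : ℂ) * Real.sin a + Real.cos a * Real.cos a = 1 := by
      rw [← sq, ← sq]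
      exact_mod_cast Real.sin_sq_add_cos_sq a
    have hz : (C : ℂ) + S * Complex.I = Complex.exp (a * Complex.I) *
        ((l + Real.sin |a| + Real.sin |b| : ℝ) + (signedVersine b - signedVersine a : ℝ) *
          Complex.I) := by
      rw [h6, ← hre, ← him]
      push_cast
      push_cast at h7
      linear_combination (-(C : ℂ) - S * Complex.I) * h7 + (Complex.sin a * Complex.sin a * C -
        Complex.sin a * Complex.cos a * S) * Complex.I_sq
    rw [hz, key]
    push_cast
    ring
  · rfl

end Track

namespace Heading

variable {θ : ℝ → ℝ} {t u : ℝ}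

theorem abs_heading_sub_le (hθ : LipschitzWith 1 θ) (x y : ℝ) : |θ x - θ y| ≤ |x - y| := by
  simpa [Real.dist_eq] using hθ.dist_le_mul x y

theorem integral_le_integral_comp_left (hθ : LipschitzWith 1 θ) {g : ℝ → ℝ} (hg : Continuous g)
    (hmono : MonotoneOn g (Icc 0 1)) (h0 : 0 ≤ g 0) {a b : ℝ} (hab : a ≤ b) (hba : b ≤ a + 1) :
    ∫ w in (0 : ℝ)..|θ a - θ b|, g w ≤ ∫ w in a..b, g |θ w - θ b| := by
  have hc := hθ.continuous
  have hlip := abs_heading_sub_le hθ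
  set r := |θ a - θ b| with hr
  have hr0 : 0 ≤ r := abs_nonneg _
  have hrab : r ≤ b - a := by
    have := hlip a b
    rwa [abs_sub_comm a b, abs_of_nonneg (sub_nonneg.2 hab)] at this
  have hint : ∀ c d, IntervalIntegrable (fun w => g |θ w - θ b|) MeasureTheory.volume c d :=
    fun c d => Continuous.intervalIntegrable (by fun_prop) _ _
  have hmem : ∀ w ∈ Icc a b, |θ w - θ b| ∈ Icc (0 : ℝ) 1 := fun w hw => by
    refine ⟨abs_nonneg _, (hlip w b).trans ?_⟩
    rw [abs_sub_comm, abs_of_nonneg (by linarith [hw.2])]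
    linarith [hw.1]
  rw [← intervalIntegral.integral_add_adjacent_intervals (hint a (a + r)) (hint (a + r) b)]
  have h2 : 0 ≤ ∫ w in (a + r)..b, g |θ w - θ b| := by
    refine intervalIntegral.integral_nonneg (by linarith) fun w hw => ?_
    have := hmem w ⟨by linarith [hw.1], hw.2⟩
    exact h0.trans (hmono ⟨le_rfl, zero_le_one⟩ this this.1)
  have h1 : ∫ w in a..(a + r), g ((a + r) - w) ≤ ∫ w in a..(a + r), g |θ w - θ b| := by
    refine intervalIntegral.integral_mono_on (by linarith)
      (Continuous.intervalIntegrable (by fun_prop) _ _) (hint _ _) fun w hw => ?_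
    refine hmono ⟨by linarith [hw.2], by linarith [hw.1]⟩
      (hmem w ⟨hw.1, by linarith [hw.2]⟩) ?_
    have e1 : |θ a - θ b| ≤ |θ a - θ w| + |θ w - θ b| := abs_sub_le _ _ _
    have e2 := hlip a w
    rw [abs_sub_comm a w, abs_of_nonneg (sub_nonneg.2 hw.1)] at e2
    linarith
  rw [intervalIntegral.integral_comp_sub_left (fun w => g w)] at h1
  simp only [sub_self, add_sub_cancel_left] at h1
  linarith

theorem integral_le_integral_comp_right (hθ : LipschitzWith 1 θ) {g : ℝ → ℝ} (hg : Continuous g)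
    (hmono : MonotoneOn g (Icc 0 1)) (h0 : 0 ≤ g 0) {a b : ℝ} (hab : a ≤ b) (hba : b ≤ a + 1) :
    ∫ w in (0 : ℝ)..|θ b - θ a|, g w ≤ ∫ w in a..b, g |θ w - θ a| := by
  have hθ' : LipschitzWith 1 fun w => θ (-w) := by
    refine LipschitzWith.of_dist_le_mul fun x y => (hθ.dist_le_mul _ _).trans_eq ?_
    rw [dist_neg_neg]
  have h := integral_le_integral_comp_left hθ' hg hmono h0 (a := -b) (b := -a) (by linarith)
    (by linarith)
  rw [intervalIntegral.integral_comp_neg (fun w => g |θ w - θ (-(-a))|)] at h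
  simpa using h

theorem integral_add_integral_le (hθ : LipschitzWith 1 θ) (hθ0 : θ 0 = 0) {g : ℝ → ℝ}
    (hg : Continuous g) (hmono : MonotoneOn g (Icc 0 1)) (h0 : 0 ≤ g 0) (ht : t ≤ 1)
    (hu : u ∈ Icc 0 t) :
    (∫ w in (0 : ℝ)..|θ u|, g w) + ∫ w in (0 : ℝ)..|θ u - θ t|, g w
      ≤ ∫ w in (0 : ℝ)..t, g |θ w - θ u| := by
  have hc := hθ.continuous
  have hint : ∀ c d, IntervalIntegrable (fun w => g |θ w - θ u|) MeasureTheory.volume c d :=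
    fun c d => Continuous.intervalIntegrable (by fun_prop) _ _
  have h1 := integral_le_integral_comp_left hθ hg hmono h0 hu.1 (by linarith [hu.2])
  have h2 := integral_le_integral_comp_right hθ hg hmono h0 hu.2 (by linarith [hu.1])
  rw [hθ0, zero_sub, abs_neg] at h1
  rw [abs_sub_comm] at h2
  rw [← intervalIntegral.integral_add_adjacent_intervals (hint 0 u) (hint u t)]
  exact add_le_add h1 h2

/-- The component orthogonal to the direction `φ` of the segment from the end of an arc from
heading `0` to heading `φ` to the start of an arc from heading `φ` to heading `θ t`, if these arcs
and the segment should replace the curve with heading `θ` on `[0, t]`. -/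
noncomputable def offset (θ : ℝ → ℝ) (t φ : ℝ) : ℝ :=
  Real.cos φ * (∫ w in (0 : ℝ)..t, Real.sin (θ w)) - Real.sin φ * (∫ w in (0 : ℝ)..t, Real.cos (θ w))
    + signedVersine φ + signedVersine (φ - θ t)

/-- The component in direction `φ` of the same segment. -/
noncomputable def straight (θ : ℝ → ℝ) (t φ : ℝ) : ℝ :=
  Real.cos φ * (∫ w in (0 : ℝ)..t, Real.cos (θ w)) + Real.sin φ * (∫ w in (0 : ℝ)..t, Real.sin (θ w))
    - Real.sin |φ| - Real.sin |φ - θ t|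

theorem hasDerivAt_offset (θ : ℝ → ℝ) (t φ : ℝ) :
    HasDerivAt (offset θ t) (-straight θ t φ) φ := by
  have h := ((((Real.hasDerivAt_cos φ).mul_const (∫ w in (0 : ℝ)..t, Real.sin (θ w))).sub
    ((Real.hasDerivAt_sin φ).mul_const (∫ w in (0 : ℝ)..t, Real.cos (θ w)))).add
    (hasDerivAt_signedVersine φ)).add
      ((hasDerivAt_signedVersine (φ - θ t)).comp φ ((hasDerivAt_id φ).sub_const (θ t)))
  refine h.congr_deriv ?_
  rw [straight]
  ring

theorem integral_cos_sub (hθ : Continuous θ) (t φ : ℝ) :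
    ∫ w in (0 : ℝ)..t, Real.cos (θ w - φ) = Real.cos φ * (∫ w in (0 : ℝ)..t, Real.cos (θ w)) +
      Real.sin φ * (∫ w in (0 : ℝ)..t, Real.sin (θ w)) := by
  rw [← intervalIntegral.integral_const_mul, ← intervalIntegral.integral_const_mul,
    ← intervalIntegral.integral_add (Continuous.intervalIntegrable (by fun_prop) _ _)
    (Continuous.intervalIntegrable (by fun_prop) _ _)]
  refine intervalIntegral.integral_congr fun w _ => ?_
  simp only [Real.cos_sub]
  ring

theorem integral_sin_sub (hθ : Continuous θ) (t φ : ℝ) :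
    ∫ w in (0 : ℝ)..t, Real.sin (θ w - φ) = Real.cos φ * (∫ w in (0 : ℝ)..t, Real.sin (θ w)) -
      Real.sin φ * (∫ w in (0 : ℝ)..t, Real.cos (θ w)) := by
  rw [← intervalIntegral.integral_const_mul, ← intervalIntegral.integral_const_mul,
    ← intervalIntegral.integral_sub (Continuous.intervalIntegrable (by fun_prop) _ _)
    (Continuous.intervalIntegrable (by fun_prop) _ _)]
  refine intervalIntegral.integral_congr fun w _ => ?_
  simp only [Real.sin_sub]
  ring

theorem sin_add_sin_le (hθ : LipschitzWith 1 θ) (ht : t ≤ 1) (hu : u ∈ Icc 0 t) :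
    Real.sin u + Real.sin (t - u) ≤ straight θ t (θ u) + Real.sin |θ u| + Real.sin |θ u - θ t| := by
  have hc := hθ.continuous
  have h1 : ∫ w in (0 : ℝ)..t, Real.cos (w - u) ≤ ∫ w in (0 : ℝ)..t, Real.cos (θ w - θ u) := by
    refine intervalIntegral.integral_mono_on (hu.1.trans hu.2)
      (Continuous.intervalIntegrable (by fun_prop) _ _)
      (Continuous.intervalIntegrable (by fun_prop) _ _) fun w hw => ?_
    rw [← Real.cos_abs (w - u), ← Real.cos_abs (θ w - θ u)]
    refine Real.cos_le_cos_of_nonneg_of_le_pi (abs_nonneg _) ?_ (abs_heading_sub_le hθ w u)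
    have : |w - u| ≤ 1 := abs_le.2 ⟨by linarith [hw.1, hu.2], by linarith [hw.2, hu.1]⟩
    linarith [Real.pi_gt_three]
  rw [intervalIntegral.integral_comp_sub_right (fun w => Real.cos w), integral_cos, zero_sub,
    Real.sin_neg, integral_cos_sub hc] at h1
  rw [straight]
  linarith

theorem straight_nonneg (hθ : LipschitzWith 1 θ) (hθ0 : θ 0 = 0) (ht : t ≤ 1) (hu : u ∈ Icc 0 t) :
    0 ≤ straight θ t (θ u) := by
  have h := sin_add_sin_le hθ ht hu
  have h1 : |θ u| ≤ u := by
    simpa [hθ0, abs_of_nonneg hu.1] using abs_heading_sub_le hθ u 0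
  have h2 : |θ u - θ t| ≤ t - u := by
    have := abs_heading_sub_le hθ u t
    rwa [abs_sub_comm u t, abs_of_nonneg (sub_nonneg.2 hu.2)] at this
  have h3 := Real.sin_le_sin_of_le_of_le_pi_div_two
    (by linarith [abs_nonneg (θ u), Real.pi_gt_three])
    (by linarith [hu.1, hu.2, Real.pi_gt_three]) h1
  have h4 := Real.sin_le_sin_of_le_of_le_pi_div_two
    (by linarith [abs_nonneg (θ u - θ t), Real.pi_gt_three])
    (by linarith [hu.1, hu.2, Real.pi_gt_three]) h2
  linarith

theorem abs_add_abs_of_straight_eq_zero (hθ : LipschitzWith 1 θ) (hθ0 : θ 0 = 0) (ht : t ≤ 1)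
    (hu : u ∈ Icc 0 t) (hs : straight θ t (θ u) = 0) : |θ u| + |θ u - θ t| = t := by
  have h := sin_add_sin_le hθ ht hu
  have h1 : |θ u| ≤ u := by
    simpa [hθ0, abs_of_nonneg hu.1] using abs_heading_sub_le hθ u 0
  have h2 : |θ u - θ t| ≤ t - u := by
    have := abs_heading_sub_le hθ u t
    rwa [abs_sub_comm u t, abs_of_nonneg (sub_nonneg.2 hu.2)] at this
  have hmem : ∀ x : ℝ, 0 ≤ x → x ≤ 1 → x ∈ Icc (-(Real.pi / 2)) (Real.pi / 2) := fun x h h' =>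
    ⟨by linarith [Real.pi_gt_three], by linarith [Real.pi_gt_three]⟩
  have m1 := hmem u hu.1 (hu.2.trans ht)
  have m2 := hmem (t - u) (by linarith [hu.2]) (by linarith [hu.1])
  have m3 := hmem _ (abs_nonneg (θ u)) (by linarith [hu.2])
  have m4 := hmem _ (abs_nonneg (θ u - θ t)) (by linarith [hu.1])
  have h3 := Real.strictMonoOn_sin.monotoneOn m3 m1 h1
  have h4 := Real.strictMonoOn_sin.monotoneOn m4 m2 h2
  have h5 := Real.injOn_sin m3 m1 (by linarith)
  have h6 := Real.injOn_sin m4 m2 (by linarith)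
  linarith

theorem abs_add_straight_add_abs_le (hθ : LipschitzWith 1 θ) (hθ0 : θ 0 = 0) (ht : t ≤ 1)
    (hu : u ∈ Icc 0 t) : |θ u| + straight θ t (θ u) + |θ u - θ t| ≤ t := by
  have hc := hθ.continuous
  have hmono : MonotoneOn (fun x => 1 - Real.cos x) (Icc 0 1) := fun x hx y hy hxy =>
    sub_le_sub_left (Real.cos_le_cos_of_nonneg_of_le_pi hx.1
      (hy.2.trans (by linarith [Real.pi_gt_three])) hxy) 1
  have h := integral_add_integral_le hθ hθ0 (g := fun x => 1 - Real.cos x) (by fun_prop) hmono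
    (by simp) ht hu
  have e : ∀ r : ℝ, ∫ w in (0 : ℝ)..r, (1 - Real.cos w) = r - Real.sin r := fun r => by
    rw [intervalIntegral.integral_sub (by simp)
      (Continuous.intervalIntegrable (by fun_prop) _ _)]
    simp
  simp only [Real.cos_abs] at h
  rw [e, e, intervalIntegral.integral_sub (by simp)
      (Continuous.intervalIntegrable (by fun_prop) _ _), integral_cos_sub hc] at h
  simp only [intervalIntegral.integral_const, sub_zero, smul_eq_mul, mul_one] at h
  rw [straight]
  linarith

theorem integral_sin_of_nonneg {r : ℝ} (hr : 0 ≤ r) :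
    ∫ w in (0 : ℝ)..r, Real.sin w = signedVersine r := by
  rw [signedVersine_of_nonneg hr, integral_sin, Real.cos_zero]

theorem offset_nonpos (hθ : LipschitzWith 1 θ) (hθ0 : θ 0 = 0) (ht : t ≤ 1) (hu : u ∈ Icc 0 t)
    (hmax : ∀ w ∈ Icc 0 t, θ w ≤ θ u) : offset θ t (θ u) ≤ 0 := by
  have hc := hθ.continuous
  have ht0 := hu.1.trans hu.2
  have hmono : MonotoneOn Real.sin (Icc 0 1) := Real.strictMonoOn_sin.monotoneOn.mono
    (Icc_subset_Icc (by linarith [Real.pi_gt_three]) (by linarith [Real.pi_gt_three]))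
  have h := integral_add_integral_le hθ hθ0 Real.continuous_sin hmono (by simp) ht hu
  have h1 : 0 ≤ θ u := hθ0 ▸ hmax 0 ⟨le_rfl, ht0⟩
  have h2 : 0 ≤ θ u - θ t := sub_nonneg.2 (hmax t ⟨ht0, le_rfl⟩)
  have e : ∫ w in (0 : ℝ)..t, Real.sin |θ w - θ u| = -∫ w in (0 : ℝ)..t, Real.sin (θ w - θ u) := by
    rw [← intervalIntegral.integral_neg]
    refine intervalIntegral.integral_congr fun w hw => ?_
    rw [uIcc_of_le ht0] at hw
    rw [abs_of_nonpos (sub_nonpos.2 (hmax w hw)), Real.sin_neg]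
  rw [e, abs_of_nonneg h1, abs_of_nonneg h2, integral_sin_of_nonneg h1, integral_sin_of_nonneg h2,
    integral_sin_sub hc] at h
  rw [offset]
  linarith

theorem offset_neg (θ : ℝ → ℝ) (t φ : ℝ) : offset (fun w => -θ w) t (-φ) = -offset θ t φ := by
  have : -φ - -θ t = -(φ - θ t) := by ring
  simp only [offset, Real.sin_neg, Real.cos_neg, this, signedVersine_neg,
    intervalIntegral.integral_neg]
  ring

theorem offset_nonneg (hθ : LipschitzWith 1 θ) (hθ0 : θ 0 = 0) (ht : t ≤ 1) (hu : u ∈ Icc 0 t)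
    (hmin : ∀ w ∈ Icc 0 t, θ u ≤ θ w) : 0 ≤ offset θ t (θ u) := by
  have h := offset_nonpos (θ := fun w => -θ w) hθ.neg (by simp [hθ0]) ht hu
    (fun w hw => neg_le_neg (hmin w hw))
  rw [offset_neg] at h
  linarith

theorem continuous_offset (hθ : Continuous θ) :
    Continuous fun p : ℝ × ℝ => offset θ p.1 (θ p.2) := by
  have h1 : Continuous fun t => ∫ w in (0 : ℝ)..t, Real.sin (θ w) :=
    intervalIntegral.continuous_primitive
      (fun a b => Continuous.intervalIntegrable (by fun_prop) _ _) 0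
  have h2 : Continuous fun t => ∫ w in (0 : ℝ)..t, Real.cos (θ w) :=
    intervalIntegral.continuous_primitive
      (fun a b => Continuous.intervalIntegrable (by fun_prop) _ _) 0
  have h3 := continuous_signedVersine
  unfold offset
  fun_prop

theorem continuous_straight (hθ : Continuous θ) :
    Continuous fun p : ℝ × ℝ => straight θ p.1 (θ p.2) := by
  have h1 : Continuous fun t => ∫ w in (0 : ℝ)..t, Real.sin (θ w) :=
    intervalIntegral.continuous_primitive
      (fun a b => Continuous.intervalIntegrable (by fun_prop) _ _) 0
  have h2 : Continuous fun t => ∫ w in (0 : ℝ)..t, Real.cos (θ w) :=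
    intervalIntegral.continuous_primitive
      (fun a b => Continuous.intervalIntegrable (by fun_prop) _ _) 0
  unfold straight
  fun_prop

theorem exists_offset_eq_zero (hθ : LipschitzWith 1 θ) (hθ0 : θ 0 = 0) (ht0 : 0 ≤ t) (ht : t ≤ 1) :
    ∃ u ∈ Icc 0 t, offset θ t (θ u) = 0 := by
  have hne : (Icc 0 t).Nonempty := ⟨0, le_rfl, ht0⟩
  obtain ⟨p, hp, hpmax⟩ := isCompact_Icc.exists_isMaxOn hne hθ.continuous.continuousOn
  obtain ⟨q, hq, hqmin⟩ := isCompact_Icc.exists_isMinOn hne hθ.continuous.continuousOn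
  have hc : ContinuousOn (fun u => offset θ t (θ u)) (Icc 0 t) :=
    ((continuous_offset hθ.continuous).comp (Continuous.prodMk_right t)).continuousOn
  exact isPreconnected_Icc.intermediate_value hp hq hc
    ⟨offset_nonpos hθ hθ0 ht hp fun w hw => hpmax hw,
      offset_nonneg hθ hθ0 ht hq fun w hw => hqmin hw⟩

/-- If the direction of the segment is not unique then the segment is degenerate and the two arcs
turn to the same side. -/
theorem straight_eq_zero_of_lt (hθ : LipschitzWith 1 θ) (hθ0 : θ 0 = 0) (ht : t ≤ 1) {p q : ℝ}
    (hp : p ∈ Icc 0 t) (hq : q ∈ Icc 0 t) (hpq : θ p < θ q)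
    (h0p : offset θ t (θ p) = 0) (h0q : offset θ t (θ q) = 0) :
    straight θ t (θ p) = 0 ∧ straight θ t (θ q) = 0 ∧
      θ p ∈ uIcc 0 (θ t) ∧ θ q ∈ uIcc 0 (θ t) := by
  have hrange : ∀ φ ∈ Icc (θ p) (θ q), ∃ u ∈ Icc 0 t, θ u = φ := fun φ hφ =>
    isPreconnected_Icc.intermediate_value hp hq hθ.continuous.continuousOn hφ
  have hsc : Continuous (straight θ t) := by
    unfold straight
    fun_prop
  have hanti : AntitoneOn (offset θ t) (Icc (θ p) (θ q)) := by
    refine antitoneOn_of_deriv_nonpos (convex_Icc _ _)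
      (fun φ _ => (hasDerivAt_offset θ t φ).continuousAt.continuousWithinAt)
      (fun φ _ => (hasDerivAt_offset θ t φ).differentiableAt.differentiableWithinAt) fun φ hφ => ?_
    obtain ⟨u, hu, rfl⟩ := hrange φ (interior_subset hφ)
    rw [(hasDerivAt_offset θ t _).deriv]
    linarith [straight_nonneg hθ hθ0 ht hu]
  have hzero : ∀ φ ∈ Icc (θ p) (θ q), offset θ t φ = 0 := fun φ hφ =>
    le_antisymm (h0p ▸ hanti ⟨le_rfl, hpq.le⟩ hφ hφ.1) (h0q ▸ hanti hφ ⟨hpq.le, le_rfl⟩ hφ.2)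
  have hs_open : EqOn (straight θ t) 0 (Ioo (θ p) (θ q)) := fun φ hφ => by
    have hev : offset θ t =ᶠ[nhds φ] fun _ => 0 :=
      Filter.eventually_of_mem (Icc_mem_nhds hφ.1 hφ.2) hzero
    have := (hasDerivAt_offset θ t φ).unique ((hasDerivAt_const φ (0 : ℝ)).congr_of_eventuallyEq hev)
    simpa using this
  have hs : EqOn (straight θ t) 0 (Icc (θ p) (θ q)) := by
    rw [← closure_Ioo hpq.ne]
    exact hs_open.closure hsc continuous_zero
  have habs : ∀ φ ∈ Icc (θ p) (θ q), |φ| + |φ - θ t| = t := fun φ hφ => by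
    obtain ⟨u, hu, rfl⟩ := hrange φ hφ
    exact abs_add_abs_of_straight_eq_zero hθ hθ0 ht hu (hs hφ)
  have a1 := habs _ ⟨le_rfl, hpq.le⟩
  have a2 := habs _ ⟨hpq.le, le_rfl⟩
  have a3 := habs ((θ p + θ q) / 2) ⟨by linarith, by linarith⟩
  refine ⟨hs ⟨le_rfl, hpq.le⟩, hs ⟨hpq.le, le_rfl⟩, ?_⟩
  rw [mem_uIcc, mem_uIcc]
  generalize θ p = x at *
  generalize θ q = y at *
  generalize θ t = z at *
  clear hs hs_open hzero hanti hsc hrange habs h0p h0q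
  grind

end Heading
open Topology

theorem HasDerivWithinAt.norm_le_one_of_lipschitzOnWith {E : Type*} [NormedAddCommGroup E]
    [NormedSpace ℝ E] {f : ℝ → E} {f' : E} {s : Set ℝ} {t : ℝ} (hf : HasDerivWithinAt f f' s t)
    (hs : UniqueDiffWithinAt ℝ s t) (ht : t ∈ s) (hlip : LipschitzOnWith 1 f s) : ‖f'‖ ≤ 1 := by
  have hne : (𝓝[s \ {t}] t).NeBot := by
    have := uniqueDiffWithinAt_iff_accPt.1 hs
    rwa [accPt_principal_iff_nhdsWithin] at this
  refine le_of_tendsto (hasDerivWithinAt_iff_tendsto_slope.1 hf).norm ?_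
  filter_upwards [self_mem_nhdsWithin] with y hy
  have h := hlip.dist_le_mul y hy.1 t ht
  rw [NNReal.coe_one, one_mul, dist_eq_norm, dist_eq_norm] at h
  rw [slope_def_module, norm_smul, norm_inv, inv_mul_le_iff₀ (norm_pos_iff.2 (sub_ne_zero.2 hy.2)),
    mul_one]
  exact h

namespace Track

variable {T : Track} {X Y d : ℂ} {h : ℝ}

theorem Admissible.norm_initial (hT : Admissible X Y d T) : ‖X‖ = 1 := by
  rw [← hT.initial]
  exact hT.norm_eq 0 ⟨le_rfl, hT.nonneg⟩

theorem Admissible.re_div_pos (hT : Admissible X Y d T) {τ : ℝ} (h0 : 0 ≤ τ) (h1 : τ ≤ 1)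
    (hτ : τ ≤ T.1) : 0 < (T.2 τ / X).re := by
  have hX := hT.norm_initial
  have hX0 : X ≠ 0 := norm_ne_zero_iff.1 (by rw [hX]; exact one_ne_zero)
  have hw : ‖T.2 τ / X‖ = 1 := by rw [norm_div, hX, hT.norm_eq τ ⟨h0, hτ⟩, div_one]
  have hd : ‖T.2 τ / X - 1‖ ≤ 1 := by
    have := hT.lipschitz.dist_le_mul τ ⟨h0, hτ⟩ 0 ⟨le_rfl, hT.nonneg⟩
    rw [hT.initial, dist_eq_norm, Real.dist_eq, sub_zero, abs_of_nonneg h0] at this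
    rw [← div_self hX0, ← sub_div, norm_div, hX, div_one]
    refine this.trans ?_
    simpa using h1
  have e1 : (T.2 τ / X).re * (T.2 τ / X).re + (T.2 τ / X).im * (T.2 τ / X).im = 1 := by
    rw [← Complex.normSq_apply, Complex.normSq_eq_norm_sq, hw, one_pow]
  have e2 : ((T.2 τ / X).re - 1) * ((T.2 τ / X).re - 1) + (T.2 τ / X).im * (T.2 τ / X).im ≤ 1 := by
    have := Complex.normSq_apply (T.2 τ / X - 1)
    rw [Complex.normSq_eq_norm_sq] at this
    simp only [Complex.sub_re, Complex.one_re, Complex.sub_im, Complex.one_im, sub_zero] at this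
    rw [← this]
    exact pow_le_one₀ (norm_nonneg _) hd
  linarith

/-- A track of length at most one has a continuous heading. -/
theorem Admissible.exists_heading (hT : Admissible X Y d T) (h0 : 0 ≤ h) (h1 : h ≤ 1)
    (hh : h ≤ T.1) : ∃ θ : ℝ → ℝ, LipschitzWith 1 θ ∧ θ 0 = 0 ∧
      ∀ τ ∈ Icc 0 h, T.2 τ = X * Complex.exp (θ τ * Complex.I) := by
  have hX := hT.norm_initial
  have hX0 : X ≠ 0 := norm_ne_zero_iff.1 (by rw [hX]; exact one_ne_zero)
  have hw : ∀ τ ∈ Icc 0 h, ‖T.2 τ / X‖ = 1 := fun τ hτ => by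
    rw [norm_div, hX, hT.norm_eq τ ⟨hτ.1, hτ.2.trans hh⟩, div_one]
  have hre : ∀ τ ∈ Icc 0 h, 0 < (T.2 τ / X).re := fun τ hτ =>
    hT.re_div_pos hτ.1 (hτ.2.trans h1) (hτ.2.trans hh)
  have hlip : LipschitzOnWith 1 (fun τ => (T.2 τ / X).arg) (Icc 0 h) := by
    refine ((hT.piecewise.restrict_left
      (fun p q p' q' h1 _ h2 hp => hp.mono (Icc_subset_Icc h1 h2)) h0 hh).imp
      fun a b ha hab hb hP => ?_).lipschitzOnWith
    rcases hab.eq_or_lt with rfl | hab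
    · rintro x ⟨hx, hx'⟩ y ⟨hy, hy'⟩
      simp [le_antisymm hx' hx, le_antisymm hy' hy]
    have hsub : Icc a b ⊆ Icc 0 h := Icc_subset_Icc ha hb
    have hder : ∀ τ ∈ Icc a b, HasDerivWithinAt (fun τ => (T.2 τ / X).arg)
        (derivWithin T.2 (Icc a b) τ / X / (T.2 τ / X)).im (Icc a b) τ := fun τ hτ => by
      have hd := ((hP.differentiableOn one_ne_zero) τ hτ).hasDerivWithinAt
      have := Complex.imCLM.hasFDerivAt.comp_hasDerivWithinAt τ
        ((hd.div_const X).clog_real (Or.inl (hre τ (hsub hτ))))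
      simpa only [Function.comp_def, Complex.imCLM_apply, Complex.log_im] using this
    refine (convex_Icc a b).lipschitzOnWith_of_nnnorm_hasDerivWithin_le hder fun τ hτ => ?_
    rw [← NNReal.coe_le_coe, coe_nnnorm, NNReal.coe_one]
    refine (Complex.abs_im_le_norm _).trans ?_
    rw [norm_div, hw τ (hsub hτ), norm_div, hX, div_one, div_one]
    exact ((hP.differentiableOn one_ne_zero) τ hτ).hasDerivWithinAt.norm_le_one_of_lipschitzOnWith
      (uniqueDiffOn_Icc hab τ hτ) hτ
      (hT.lipschitz.mono (Icc_subset_Icc ha (hb.trans hh)))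
  refine ⟨fun τ => (T.2 (projIcc 0 h h0 τ) / X).arg, ?_, ?_, fun τ hτ => ?_⟩
  · refine LipschitzWith.of_dist_le_mul fun x y => ?_
    refine (hlip.dist_le_mul _ (projIcc 0 h h0 x).2 _ (projIcc 0 h h0 y).2).trans ?_
    rw [NNReal.coe_one, one_mul, one_mul]
    simpa [Subtype.dist_eq] using (LipschitzWith.projIcc h0).dist_le_mul x y
  · simp only [projIcc_left]
    rw [hT.initial, div_self hX0, Complex.arg_one]
  · simp only [projIcc_of_mem h0 hτ]
    have := Complex.norm_mul_exp_arg_mul_I (T.2 τ / X)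
    rw [hw τ hτ, Complex.ofReal_one, one_mul] at this
    rw [this, mul_div_cancel₀ _ hX0]

theorem turn_add {a c τ : ℝ} (ha : a ∈ uIcc 0 c) (hτ : |a| ≤ τ) :
    a + turn (c - a) (τ - |a|) = turn c τ := by
  have key : ∀ a c : ℝ, 0 ≤ a → a ≤ c → |a| ≤ τ → a + turn (c - a) (τ - |a|) = turn c τ := by
    intro a c h1 h2 hτ
    rw [abs_of_nonneg h1] at hτ ⊢
    rw [turn_of_nonneg (by linarith) (by linarith), turn_of_nonneg (by linarith) (by linarith),
      min_sub_sub_right]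
    ring
  rcases mem_uIcc.1 ha with h | h
  · exact key a c h.1 h.2 hτ
  · have := key (-a) (-c) (by linarith [h.2]) (by linarith [h.1]) (by rwa [abs_neg])
    rw [abs_neg, ← neg_sub', turn_neg, turn_neg] at this
    linarith

theorem turn_eq_of_le {a c τ : ℝ} (ha : a ∈ uIcc 0 c) (hτ : τ ≤ |a|) : turn a τ = turn c τ := by
  have key : ∀ a c : ℝ, 0 ≤ a → a ≤ c → τ ≤ |a| → turn a τ = turn c τ := by
    intro a c h1 h2 hτ
    rcases le_total τ 0 with h | h
    · rw [turn_of_nonpos h, turn_of_nonpos h]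
    rw [abs_of_nonneg h1] at hτ
    rw [turn_of_nonneg h1 h, turn_of_nonneg (by linarith) h, min_eq_left hτ,
      min_eq_left (hτ.trans h2)]
  rcases mem_uIcc.1 ha with h | h
  · exact key a c h.1 h.2 hτ
  · have := key (-a) (-c) (by linarith [h.2]) (by linarith [h.1]) (by rwa [abs_neg])
    rw [turn_neg, turn_neg] at this
    linarith

theorem dubins_eq_arc (X : ℂ) {a c : ℝ} (ha : a ∈ uIcc 0 c) : dubins X a 0 (c - a) = arc X c := by
  refine Prod.ext ?_ (ContinuousMap.ext fun τ => ?_)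
  · rw [dubins_fst, arc_fst, zero_add]
    rcases mem_uIcc.1 ha with h | h
    · rw [abs_of_nonneg h.1, abs_of_nonneg (by linarith), abs_of_nonneg (by linarith)]; ring
    · rw [abs_of_nonpos h.2, abs_of_nonpos (by linarith), abs_of_nonpos (by linarith)]; ring
  · have h1 : (arc (X * Complex.exp (a * Complex.I)) (c - a)).2 0
        = (segment (X * Complex.exp (a * Complex.I)) 0).2 0 := arc_initial _ _
    rcases le_total τ |a| with hτ | hτ
    · rw [dubins, concat_of_le _ hτ, arc_apply, arc_apply, turn_eq_of_le ha hτ]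
      rw [concat_of_le h1 (show (0 : ℝ) ≤ _ from le_rfl), arc_fst, arc_terminal]
      rfl
    · have e : (segment (X * Complex.exp (a * Complex.I)) 0).1 = 0 := rfl
      rw [dubins, concat_of_ge hτ, concat_of_ge (by rw [e, arc_fst]; linarith), arc_apply,
        arc_apply, e, sub_zero, arc_fst, ← turn_add ha hτ, mul_assoc, ← Complex.exp_add]
      congr 2
      push_cast
      ring

theorem concat_eq_right {S : Track} {Z e : ℂ} (hS : Admissible X Z e S) (h0 : S.1 = 0)
    (hT : Admissible X Y d T) : concat S T = T := by
  refine Prod.ext (by rw [concat_fst, h0, zero_add]) (ContinuousMap.ext fun τ => ?_)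
  rw [concat_apply, h0, hS.of_nonpos _ (min_le_right _ _), hS.initial, sub_zero,
    add_sub_cancel_left]
  rcases le_total τ 0 with h | h
  · rw [max_eq_right h, hT.initial, hT.of_nonpos τ h]
  · rw [max_eq_left h]

/-- The tracks of the elements of `Γ(x, y)`, where `x` and `y` have tangent vectors `X` and `Y` and
`d` is the displacement from `x` to `y`. -/
def pathTracks (X Y d : ℂ) : Set Track := {T | Admissible X Y d T ∧ 0 < T.1}

/-- The initial piece of length `h ≤ 1` of a track is homotopic to a track of type
arc–segment–arc that is not longer. -/
theorem exists_joinedIn_concat_tail (hT : Admissible X Y d T) (h0 : 0 < h) (h1 : h ≤ 1)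
    (hh : h ≤ T.1) : ∃ D : Track, D.IsCS ∧ D.1 ≤ h ∧
      Admissible X (T.2 h) (∫ τ in (0 : ℝ)..h, T.2 τ) D ∧
      JoinedIn (pathTracks X Y d) T (concat D (tail T h)) := by
  have hX := hT.norm_initial
  obtain ⟨θ, hθ, hθ0, hθT⟩ := hT.exists_heading h0.le h1 hh
  have hc := hθ.continuous
  have hex : ∀ t : Icc 0 h, ∃ u ∈ Icc 0 (t : ℝ), Heading.offset θ t (θ u) = 0 := fun t =>
    Heading.exists_offset_eq_zero hθ hθ0 t.2.1 (t.2.2.trans h1)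
  choose u hu hu0 using hex
  let Ψ : ℝ × ℝ → Track := fun p =>
    dubins X (θ p.2) (Heading.straight θ p.1 (θ p.2)) (θ p.1 - θ p.2)
  have hΨ : Continuous Ψ := by
    have := Heading.continuous_straight hc
    exact (continuous_dubins X).comp
      (f := fun p : ℝ × ℝ => (θ p.2, Heading.straight θ p.1 (θ p.2), θ p.1 - θ p.2)) (by fun_prop)
  have huniq : ∀ t ∈ Icc 0 h, ∀ p ∈ Icc 0 t, ∀ q ∈ Icc 0 t, Heading.offset θ t (θ p) = 0 →
      Heading.offset θ t (θ q) = 0 → Ψ (t, p) = Ψ (t, q) := by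
    intro t ht
    have hlt : ∀ p ∈ Icc 0 t, ∀ q ∈ Icc 0 t, Heading.offset θ t (θ p) = 0 →
        Heading.offset θ t (θ q) = 0 → θ p < θ q → Ψ (t, p) = Ψ (t, q) := by
      intro p hp q hq hp0 hq0 hpq
      obtain ⟨e1, e2, m1, m2⟩ := Heading.straight_eq_zero_of_lt hθ hθ0 (ht.2.trans h1) hp hq hpq
        hp0 hq0
      change dubins X _ _ _ = dubins X _ _ _
      rw [e1, e2, dubins_eq_arc X m1, dubins_eq_arc X m2]
    intro p hp q hq hp0 hq0
    rcases lt_trichotomy (θ p) (θ q) with hpq | hpq | hpq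
    · exact hlt p hp q hq hp0 hq0 hpq
    · change dubins X _ _ _ = dubins X _ _ _
      rw [hpq]
    · exact (hlt q hq p hp hq0 hp0 hpq).symm
  let g : Icc 0 h → Track := fun t => Ψ (t, u t)
  have hg : Continuous g := by
    let K : Set (ℝ × ℝ) := {p | 0 ≤ p.2 ∧ p.2 ≤ p.1 ∧ p.1 ≤ h ∧ Heading.offset θ p.1 (θ p.2) = 0}
    have hKc : IsClosed K :=
      (isClosed_le continuous_const continuous_snd).inter
        ((isClosed_le continuous_snd continuous_fst).inter
          ((isClosed_le continuous_fst continuous_const).inter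
            (isClosed_eq (Heading.continuous_offset hc) continuous_const)))
    have hK : IsCompact K := (isCompact_Icc (a := ((0 : ℝ), (0 : ℝ))) (b := (h, h))).of_isClosed_subset
      hKc fun p hp => ⟨⟨hp.1.trans hp.2.1, hp.1⟩, ⟨hp.2.2.1, hp.2.1.trans hp.2.2.1⟩⟩
    have : CompactSpace K := isCompact_iff_compactSpace.1 hK
    let π : K → Icc 0 h := fun p => ⟨p.1.1, p.2.1.trans p.2.2.1, p.2.2.2.1⟩
    have hπ : Continuous π := by fun_prop
    have hsurj : Function.Surjective π := fun t =>
      ⟨⟨(t, u t), (hu t).1, (hu t).2, t.2.2, hu0 t⟩, rfl⟩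
    rw [(hπ.isClosedMap.isQuotientMap hπ hsurj).continuous_iff]
    have : g ∘ π = fun p => Ψ p.1 := funext fun p =>
      huniq _ (π p).2 _ (hu (π p)) _ ⟨p.2.1, p.2.2.1⟩ (hu0 (π p)) p.2.2.2.2
    rw [this]
    exact hΨ.comp continuous_subtype_val
  have hs : ∀ t : Icc 0 h, 0 ≤ Heading.straight θ t (θ (u t)) := fun t =>
    Heading.straight_nonneg hθ hθ0 (t.2.2.trans h1) (hu t)
  have hg_fst : ∀ t, (g t).1 =
      |θ (u t)| + (Heading.straight θ t (θ (u t)) + |θ (u t) - θ t|) := fun t => by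
    rw [abs_sub_comm (θ (u t))]
    exact dubins_fst _ _ _ _
  have hg_le : ∀ t, (g t).1 ≤ t := fun t => by
    rw [hg_fst]
    linarith [Heading.abs_add_straight_add_abs_le hθ hθ0 (t.2.2.trans h1) (hu t)]
  have hg_pos : ∀ t : Icc 0 h, 0 < (t : ℝ) → 0 < (g t).1 := fun t ht => by
    rw [hg_fst]
    rcases (hs t).eq_or_lt with h | h
    · linarith [Heading.abs_add_abs_of_straight_eq_zero hθ hθ0 (t.2.2.trans h1) (hu t) h.symm]
    · linarith [abs_nonneg (θ (u t)), abs_nonneg (θ (u t) - θ t)]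
  have hg_adm : ∀ t : Icc 0 h, Admissible X (T.2 t) (∫ τ in (0 : ℝ)..t, T.2 τ) (g t) := fun t => by
    have ho := hu0 t
    rw [Heading.offset] at ho
    have hsgn := signedVersine_neg (θ (u t) - θ t)
    rw [neg_sub] at hsgn
    have := dubins_admissible hX (a := θ (u t)) (b := θ t - θ (u t))
      (C := ∫ w in (0 : ℝ)..t, Real.cos (θ w)) (S := ∫ w in (0 : ℝ)..t, Real.sin (θ w)) (hs t)
      (by rw [abs_sub_comm, Heading.straight]; ring) (by rw [hsgn]; linarith)
    convert this using 1
    · rw [hθT t t.2, add_sub_cancel]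
    · rw [← intervalIntegral.integral_ofReal, ← intervalIntegral.integral_ofReal,
        ← intervalIntegral.integral_mul_const, ← intervalIntegral.integral_add
          (Continuous.intervalIntegrable (by fun_prop) _ _)
          (Continuous.intervalIntegrable (by fun_prop) _ _), ← intervalIntegral.integral_const_mul]
      refine intervalIntegral.integral_congr fun τ hτ => ?_
      rw [uIcc_of_le t.2.1] at hτ
      rw [hθT τ ⟨hτ.1, hτ.2.trans t.2.2⟩, Complex.exp_mul_I, Complex.ofReal_cos, Complex.ofReal_sin]
  let G : Icc 0 h → Track := fun t => concat (g t) (tail T t)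
  have hG : Continuous G :=
    continuous_concat.comp (hg.prodMk ((continuous_tail T).comp continuous_subtype_val))
  have hG_mem : ∀ t, G t ∈ pathTracks X Y d := fun t => by
    refine ⟨?_, ?_⟩
    · have := (hg_adm t).concat (hT.tail t.2.1 (t.2.2.trans hh))
      rwa [add_sub_cancel] at this
    · change 0 < (g t).1 + (T.1 - t)
      rcases t.2.1.eq_or_lt with ht | ht
      · linarith [(hg_adm t).nonneg]
      · linarith [hg_pos t ht, t.2.2]
  have hG0 : G ⟨0, le_rfl, h0.le⟩ = T := by
    have e := hg_adm ⟨0, le_rfl, h0.le⟩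
    change concat _ (tail T 0) = T
    rw [tail_zero hT]
    exact concat_eq_right e (le_antisymm (hg_le _) e.nonneg) hT
  refine ⟨g ⟨h, h0.le, le_rfl⟩, dubins_isCS (hs _), hg_le ⟨h, h0.le, le_rfl⟩,
    hg_adm ⟨h, h0.le, le_rfl⟩, ?_⟩
  have hjoin : JoinedIn (Icc 0 h) 0 h :=
    JoinedIn.of_segment_subset ((convex_Icc 0 h).segment_subset ⟨le_rfl, h0.le⟩ ⟨h0.le, le_rfl⟩)
  have hGjoin := ((joinedIn_univ.2 hjoin.joined_subtype).map hG).mono (V := pathTracks X Y d)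
    (by rintro _ ⟨t, -, rfl⟩; exact hG_mem t)
  rwa [hG0] at hGjoin

theorem exists_isCS_joinedIn (n : ℕ) : ∀ {X d : ℂ} {T : Track}, T ∈ pathTracks X Y d → T.1 ≤ n →
    ∃ S : Track, S.IsCS ∧ S.1 ≤ T.1 ∧ JoinedIn (pathTracks X Y d) T S := by
  induction n with
  | zero =>
    intro X d T hT hn
    have := hT.2
    simp only [Nat.cast_zero] at hn
    linarith
  | succ n ih =>
    intro X d T ⟨hT, hpos⟩ hn
    rcases le_or_gt T.1 1 with h1 | h1
    · obtain ⟨D, hD, hDle, hDadm, hjoin⟩ := exists_joinedIn_concat_tail hT hpos h1 le_rfl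
      have e : (tail T T.1).1 = 0 := sub_self _
      refine ⟨_, hD.concat ?_ ?_, ?_, hjoin⟩
      · rw [(hT.tail hT.nonneg le_rfl).initial, hDadm.terminal]
      · rw [IsCS, e]
        exact PiecewiseOn.refl 0
      · rwa [concat_fst, e, add_zero]
    · obtain ⟨D, hD, hDle, hDadm, hjoin⟩ := exists_joinedIn_concat_tail hT one_pos le_rfl h1.le
      have htail := hT.tail zero_le_one h1.le
      have e : (tail T 1).1 = T.1 - 1 := rfl
      obtain ⟨S, hS, hSle, hSjoin⟩ := ih ⟨htail, by rw [e]; linarith⟩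
        (by rw [e]; push_cast at hn; linarith)
      have hSadm := hSjoin.target_mem.1
      refine ⟨concat D S, hD.concat ?_ hS, ?_, hjoin.trans ?_⟩
      · rw [hSadm.initial, hDadm.terminal]
      · rw [concat_fst]
        linarith
      · have hcont : Continuous (concat D) := continuous_concat.comp (Continuous.prodMk_right D)
        refine (hSjoin.map hcont).mono ?_
        rintro _ ⟨R, hR, rfl⟩
        refine ⟨?_, ?_⟩
        · have := hDadm.concat hR.1
          rwa [add_sub_cancel] at this
        · rw [concat_fst]
          linarith [hR.2, hDadm.nonneg]

end Track

open Track

namespace BoundedCurvaturePath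

variable {x y : ℂ × ℂ} (γ : BoundedCurvaturePath x y)

theorem continuousOn_velocity : ContinuousOn (velocity γ.toFun γ.length) (Icc 0 γ.length) :=
  γ.contDiffOn_one.continuousOn_derivWithin (uniqueDiffOn_Icc γ.length_pos) le_rfl

/-- The track of a bounded curvature path. -/
noncomputable def track : Track :=
  (γ.length, ⟨IccExtend γ.length_pos.le
    ((Icc 0 γ.length).domRestrict (velocity γ.toFun γ.length)),
      (continuousOn_iff_continuous_domRestrict.1 γ.continuousOn_velocity).Icc_extend'⟩)

theorem track_apply {t : ℝ} (ht : t ∈ Icc 0 γ.length) :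
    γ.track.2 t = velocity γ.toFun γ.length t :=
  IccExtend_of_mem γ.length_pos.le
    ((Icc 0 γ.length).domRestrict (velocity γ.toFun γ.length)) ht

theorem hasDerivWithinAt {t : ℝ} (ht : t ∈ Icc 0 γ.length) :
    HasDerivWithinAt γ.toFun (velocity γ.toFun γ.length t) (Icc 0 γ.length) t :=
  (γ.contDiffOn_one.differentiableOn one_ne_zero t ht).hasDerivWithinAt

theorem integral_track {t : ℝ} (ht : t ∈ Icc 0 γ.length) :
    ∫ τ in (0 : ℝ)..t, γ.track.2 τ = γ.toFun t - x.1 := by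
  rw [← γ.map_zero]
  refine intervalIntegral.integral_eq_sub_of_hasDerivAt_of_le ht.1
    (γ.contDiffOn_one.continuousOn.mono (Icc_subset_Icc le_rfl ht.2)) (fun τ hτ => ?_)
    (γ.track.2.continuous.intervalIntegrable _ _)
  have hτ' : τ ∈ Ioo 0 γ.length := ⟨hτ.1, hτ.2.trans_le ht.2⟩
  rw [γ.track_apply (Ioo_subset_Icc_self hτ')]
  exact (γ.hasDerivWithinAt (Ioo_subset_Icc_self hτ')).hasDerivAt (Icc_mem_nhds hτ'.1 hτ'.2)

theorem piecewise_velocity : PiecewiseOn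
    (fun a b => ContDiffOn ℝ 1 (velocity γ.toFun γ.length) (Icc a b)) 0 γ.length := by
  obtain ⟨n, t, ⟨h0, hn, hlt⟩, hC⟩ := γ.piecewise_contDiffOn_two
  have h : PiecewiseOn (fun a b => a < b ∧ ContDiffOn ℝ 2 γ.toFun (Icc a b)) 0 γ.length := by
    rw [← h0, ← hn]
    exact PiecewiseOn.of_subdivision hlt fun i hi => ⟨hlt i hi, hC i hi⟩
  refine h.imp fun a b ha _ hb ⟨hab, hP⟩ => ?_
  have hd := ((contDiffOn_succ_iff_derivWithin (n := 1) (uniqueDiffOn_Icc hab)).1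
    (by simpa [one_add_one_eq_two] using hP)).2.2
  refine hd.congr fun τ hτ => ?_
  exact (((γ.hasDerivWithinAt (Icc_subset_Icc ha hb hτ)).mono (Icc_subset_Icc ha hb)).derivWithin
    (uniqueDiffOn_Icc hab τ hτ)).symm

theorem lipschitzOnWith_velocity :
    LipschitzOnWith 1 (velocity γ.toFun γ.length) (Icc 0 γ.length) := by
  refine (γ.piecewise_velocity.imp fun a b ha hab hb hP => ?_).lipschitzOnWith
  rcases hab.eq_or_lt with rfl | hab
  · rintro x ⟨hx, hx'⟩ y ⟨hy, hy'⟩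
    simp [le_antisymm hx' hx, le_antisymm hy' hy]
  rw [← closure_Ioo hab.ne]
  refine LipschitzOnWith.closure (by rw [closure_Ioo hab.ne]; exact hP.continuousOn) ?_
  have hnhds : ∀ τ ∈ Ioo a b, Icc 0 γ.length ∈ nhds τ := fun τ hτ =>
    Icc_mem_nhds (ha.trans_lt hτ.1) (hτ.2.trans_le hb)
  have hdiff : ∀ τ ∈ Ioo a b, DifferentiableAt ℝ (velocity γ.toFun γ.length) τ := fun τ hτ =>
    (hP.differentiableOn one_ne_zero τ (Ioo_subset_Icc_self hτ)).differentiableAt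
      (Icc_mem_nhds hτ.1 hτ.2)
  refine Convex.lipschitzOnWith_of_nnnorm_deriv_le hdiff (fun τ hτ => ?_) (convex_Ioo a b)
  rw [← NNReal.coe_le_coe, coe_nnnorm, NNReal.coe_one, ← derivWithin_of_mem_nhds (hnhds τ hτ)]
  exact γ.curvature_le τ (mem_of_mem_nhds (hnhds τ hτ)) (hdiff τ hτ).differentiableWithinAt

theorem track_mem : γ.track ∈ pathTracks x.2 y.2 (y.1 - x.1) := by
  have hl := γ.length_pos
  have hv : EqOn γ.track.2 (velocity γ.toFun γ.length) (Icc 0 γ.length) := fun t => γ.track_apply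
  refine ⟨⟨hl.le, fun τ hτ => ?_, ?_, ?_, fun τ hτ => ?_, fun a ha b hb => ?_, ?_⟩, hl⟩
  · rw [← γ.velocity_zero]
    exact IccExtend_of_le_left hl.le
      ((Icc 0 γ.length).domRestrict (velocity γ.toFun γ.length)) hτ
  · rw [← γ.velocity_length]
    exact γ.track_apply ⟨hl.le, le_rfl⟩
  · rw [← γ.map_length]
    exact γ.integral_track ⟨hl.le, le_rfl⟩
  · rw [hv hτ]
    exact γ.norm_velocity τ hτ
  · rw [hv ha, hv hb]
    exact γ.lipschitzOnWith_velocity ha hb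
  · exact γ.piecewise_velocity.imp fun a b ha _ hb hP => hP.congr
      fun τ hτ => hv (Icc_subset_Icc ha hb hτ)

end BoundedCurvaturePath

namespace Track

variable {x y : ℂ × ℂ} {T : Track}

theorem hasDerivAt_integral (T : Track) (c : ℂ) (t : ℝ) :
    HasDerivAt (fun t => c + ∫ τ in (0 : ℝ)..t, T.2 τ) (T.2 t) t :=
  (intervalIntegral.integral_hasDerivAt_right (T.2.continuous.intervalIntegrable _ _)
    (T.2.continuous.stronglyMeasurableAtFilter _ _) T.2.continuous.continuousAt).const_add c

theorem velocity_integral (c : ℂ) (hT : 0 < T.1) {t : ℝ} (ht : t ∈ Icc 0 T.1) :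
    velocity (fun t => c + ∫ τ in (0 : ℝ)..t, T.2 τ) T.1 t = T.2 t :=
  (T.hasDerivAt_integral c t).hasDerivWithinAt.derivWithin (uniqueDiffOn_Icc hT t ht)

theorem contDiffOn_integral (T : Track) (c : ℂ) {n : ℕ} {a b : ℝ} (hab : a < b)
    (h : ContDiffOn ℝ n T.2 (Icc a b)) :
    ContDiffOn ℝ (n + 1) (fun t => c + ∫ τ in (0 : ℝ)..t, T.2 τ) (Icc a b) := by
  refine (contDiffOn_succ_iff_derivWithin (uniqueDiffOn_Icc hab)).2
    ⟨fun t _ => (T.hasDerivAt_integral c t).differentiableAt.differentiableWithinAt, by simp, ?_⟩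
  exact h.congr fun t ht =>
    (T.hasDerivAt_integral c t).hasDerivWithinAt.derivWithin (uniqueDiffOn_Icc hab t ht)

/-- The bounded curvature path with a given track and initial point. -/
noncomputable def toPath (hT : T ∈ pathTracks x.2 y.2 (y.1 - x.1)) : BoundedCurvaturePath x y where
  length := T.1
  length_pos := hT.2
  toFun t := x.1 + ∫ τ in (0 : ℝ)..t, T.2 τ
  contDiffOn_one := by
    simpa using T.contDiffOn_integral x.1 (n := 0) hT.2 (by simpa using T.2.continuous.continuousOn)
  piecewise_contDiffOn_two := by
    obtain ⟨n, t, h0, hn, hlt, hP⟩ := hT.1.piecewise.exists_subdivision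
    refine ⟨n, t, ⟨h0, hn, hlt⟩, fun i hi => ?_⟩
    simpa [one_add_one_eq_two] using T.contDiffOn_integral x.1 (n := 1) (hlt i hi) (hP i hi)
  norm_velocity t ht := by
    rw [velocity_integral _ hT.2 ht]
    exact hT.1.norm_eq t ht
  map_zero := by simp
  velocity_zero := by
    rw [velocity_integral _ hT.2 ⟨le_rfl, hT.2.le⟩]
    exact hT.1.initial
  map_length := by
    rw [hT.1.integral]
    ring
  velocity_length := by
    rw [velocity_integral _ hT.2 ⟨hT.2.le, le_rfl⟩]
    exact hT.1.terminal
  curvature_le t ht hd := by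
    refine hd.hasDerivWithinAt.norm_le_one_of_lipschitzOnWith (uniqueDiffOn_Icc hT.2 t ht) ht ?_
    intro a ha b hb
    rw [velocity_integral _ hT.2 ha, velocity_integral _ hT.2 hb]
    exact hT.1.lipschitz ha hb

theorem exists_exp_eq {w : ℂ} {ε : ℝ} (hw : ‖w‖ = 1) (hε : ε = 1 ∨ ε = -1) :
    ∃ φ : ℝ, w = Complex.I * ε * Complex.exp (φ * Complex.I) := by
  refine ⟨(-Complex.I * ε * w).arg, ?_⟩
  have h4 : (ε : ℂ) * ε = 1 := by rcases hε with rfl | rfl <;> simp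
  have h := Complex.norm_mul_exp_arg_mul_I (-Complex.I * ε * w)
  have hn : ‖-Complex.I * ε * w‖ = 1 := by
    rcases hε with rfl | rfl <;> simp [hw]
  rw [hn, Complex.ofReal_one, one_mul] at h
  rw [h]
  linear_combination (-w) * h4 + ε * ε * w * Complex.I_mul_I

theorem toPath_isCS (hT : T ∈ pathTracks x.2 y.2 (y.1 - x.1)) (hcs : T.IsCS) :
    (toPath hT).IsCS := by
  obtain ⟨n, t, h0, hn, hlt, hP⟩ := (hcs.imp (Q := fun a b => (0 ≤ a ∧ b ≤ T.1) ∧ IsSteady T.2 a b)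
    fun a b ha _ hb h => ⟨⟨ha, hb⟩, h⟩).exists_subdivision
  refine ⟨n, t, ⟨h0, hn, hlt⟩, fun i hi => ?_⟩
  obtain ⟨⟨ha, hb⟩, hs⟩ := hP i hi
  have hab := (hlt i hi).le
  generalize t i = a at *
  generalize t (i + 1) = b at *
  have hmem : ∀ τ ∈ Icc a b, τ ∈ Icc 0 T.1 := fun τ hτ => ⟨ha.trans hτ.1, hτ.2.trans hb⟩
  have key : ∀ f : ℝ → ℂ, (∀ τ ∈ Icc a b, HasDerivAt f (T.2 τ) τ) → ∀ τ ∈ Icc a b,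
      (toPath hT).toFun τ = ((toPath hT).toFun a - f a) + f τ := by
    intro f hf τ hτ
    have hsub : uIcc a τ ⊆ Icc a b := by
      rw [uIcc_of_le hτ.1]
      exact Icc_subset_Icc le_rfl hτ.2
    have e1 := intervalIntegral.integral_eq_sub_of_hasDerivAt
      (fun s hs => hf s (hsub hs)) (T.2.continuous.intervalIntegrable a τ)
    have e2 := intervalIntegral.integral_eq_sub_of_hasDerivAt
      (fun s _ => T.hasDerivAt_integral x.1 s) (T.2.continuous.intervalIntegrable a τ)
    have e3 := e2.symm.trans e1
    change x.1 + _ = (x.1 + _) - f a + f τ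
    linear_combination e3
  rcases hs with ⟨w, hw⟩ | ⟨w, ε, hε, hw⟩
  · left
    refine ⟨(toPath hT).toFun a - a * w, w, ?_, key (fun τ => τ * w) fun τ hτ => ?_⟩
    · rw [← hw a ⟨le_rfl, hab⟩]
      exact hT.1.norm_eq a (hmem a ⟨le_rfl, hab⟩)
    · rw [hw τ hτ]
      simpa using (Complex.ofRealCLM.hasDerivAt (x := τ)).mul_const w
  · right
    have hw1 : ‖w‖ = 1 := by
      have := hT.1.norm_eq a (hmem a ⟨le_rfl, hab⟩)
      rwa [hw a ⟨le_rfl, hab⟩, norm_mul, Complex.norm_exp_ofReal_mul_I, mul_one] at this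
    obtain ⟨φ, hφ⟩ := exists_exp_eq hw1 hε
    refine ⟨_, φ, ε, hε, key (fun τ => Complex.exp (((φ + ε * τ : ℝ) : ℂ) * Complex.I))
      fun τ hτ => ?_⟩
    have h1 : HasDerivAt (fun τ : ℝ => ((φ + ε * τ : ℝ) : ℂ)) ε τ := by
      have := (((hasDerivAt_id τ).const_mul ε).const_add φ).ofReal_comp
      simpa using this
    refine (h1.mul_const Complex.I).cexp.congr_deriv ?_
    rw [hw τ hτ, hφ]
    push_cast
    rw [add_mul, Complex.exp_add]
    ring

theorem boundedHomotopic_toPath (γ : BoundedCurvaturePath x y)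
    {S : Track} (hS : S ∈ pathTracks x.2 y.2 (y.1 - x.1))
    (h : JoinedIn (pathTracks x.2 y.2 (y.1 - x.1)) γ.track S) : γ.BoundedHomotopic (toPath hS) := by
  let p := h.somePath
  have hp : ∀ t, p t ∈ pathTracks x.2 y.2 (y.1 - x.1) := h.somePath_mem
  have hpc : Continuous p := p.continuous
  have hmem : ∀ q : unitInterval × unitInterval, (q.2 : ℝ) * (p q.1).1 ∈ Icc 0 (p q.1).1 := fun q =>
    ⟨mul_nonneg q.2.2.1 (hp q.1).2.le, mul_le_of_le_one_left (hp q.1).2.le q.2.2.2⟩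
  refine ⟨fun t => toPath (hp t), ?_, ?_, ?_, ?_, ?_⟩
  · exact continuous_fst.comp hpc
  · change Continuous fun q : unitInterval × unitInterval =>
      x.1 + ∫ τ in (0 : ℝ)..((q.2 : ℝ) * (p q.1).1), (p q.1).2 τ
    refine continuous_const.add ?_
    exact intervalIntegral.continuous_parametric_intervalIntegral_of_continuous
      (f := fun (q : unitInterval × unitInterval) τ => (p q.1).2 τ) (by fun_prop) (by fun_prop)
  · have : (fun q : unitInterval × unitInterval =>
        velocity (toPath (hp q.1)).toFun (toPath (hp q.1)).length
          ((q.2 : ℝ) * (toPath (hp q.1)).length))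
        = fun q => (p q.1).2 ((q.2 : ℝ) * (p q.1).1) :=
      funext fun q => velocity_integral _ (hp q.1).2 (hmem q)
    rw [this]
    fun_prop
  · have h0 : p 0 = γ.track := p.source
    refine ⟨by change (p 0).1 = _; rw [h0]; rfl, fun t ht => ?_⟩
    change x.1 + ∫ τ in (0 : ℝ)..t, (p 0).2 τ = _
    change t ∈ Icc 0 (p 0).1 at ht
    rw [h0] at ht ⊢
    rw [γ.integral_track ht]
    ring
  · have h1 : p 1 = S := p.target
    refine ⟨by change (p 1).1 = _; rw [h1]; rfl, fun t _ => ?_⟩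
    change x.1 + ∫ τ in (0 : ℝ)..t, (p 1).2 τ = _
    rw [h1]
    rfl

end Track

theorem theorem3p5 (x y : ℂ × ℂ) (γ : BoundedCurvaturePath x y) :
    ∃ η : BoundedCurvaturePath x y,
      η.IsCS ∧ γ.BoundedHomotopic η ∧ η.length ≤ γ.length := by
  obtain ⟨n, hn⟩ := exists_nat_ge γ.length
  obtain ⟨S, hS, hle, hjoin⟩ := Track.exists_isCS_joinedIn n γ.track_mem hn
  exact ⟨Track.toPath hjoin.target_mem, Track.toPath_isCS _ hS,
    Track.boundedHomotopic_toPath γ _ hjoin, hle⟩
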